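/- **Theorem (rate of averaged increasing precision).** Let $(\mathcal F_k)_{k\ge 0}$ be an increasing sequence of $\sigma$-algebras on a probability space, let $f:\mathbb R^n\to\mathbb R$, let $x_1$ be an $\mathcal F_0$-measurable random vector in $\mathbb R^n$ with $E\|x_1\|^2<\infty$, and for $k\ge 1$ let $$x_{k+1}=x_k-A_k\big(\nabla f(x_k)+\mathcal E_k\big),$$ where $\mathcal E_k$ is an $\mathcal F_k$-measurable random vector with $E[\mathcal E_k\mid\mathcal F_{k-1}]=0$ whose conditional distribution given $\mathcal F_{k-1}$ depends only on $x_k$ and $k$, i.e. $E[g(\mathcal E_k)\mid\mathcal F_{k-1}]=E[g(\mathcal E_k)\mid x_k]$ for every measurable $g:\mathbb R^n\to\mathbb R$ with $g(\mathcal E_k)$ integrable. Assume: 1. $f$ is differentiable and $x^*$ is its only critical point; $\nabla^2 f(x)$ exists and is positive definite for every $x\in\mathbb R^n$, with $\sup_x\|\nabla^2f(x)\|_2<\infty$ and $\sup_x\|(\nabla^2f(x))^{-1}\|_2<\infty$. Moreover $f$ is $C^3$ in a neighbourhood of $x^*$. Put $S=\nabla^2f(x^*)$. 2. $(N_k)_{k\ge1}$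 is a positive nondecreasing sequence of reals with $N_k\sim\nu k^q$ as $k\to\infty$, for some constants $\nu>0$ and $q\ge0$. 3. $A_k=(k+c)^{-\alpha}D$ with $c\ge0$, $D$ symmetric positive definite, and $\max\{0,\tfrac{1-q}2\}<\alpha<1$. 4. For every integer $p\in\{2,\dots,M\}$ there is a constant $C_p$ such that, for all $k\ge1$, $N_k^{p/2}\,E[\|\mathcal E_k\|^p\mid\mathcal F_{k-1}]\le C_p$ almost surely. Here $M$ is an integer with $$M\ge 3,\qquad M\ge 2\Big\lfloor\frac1{\alpha+q}\Big\rfloor+2,\qquad M\ge2\Big\lfloor\frac1{\alpha-(1-q)/2}\Big\rfloor+2 .$$ 5. For suitable versions of the conditional expectations, the limit $\tilde U(x)=\lim_{k\to\infty}N_k\,E[\mathcal E_k\mathcal E_k^T\mid x_k=x]$ exists uniformly for $x$ in some neighbourhood of $x^*$ and is continuous there, and $\tilde U(x^*)=\Sigma^2$ is a positive semidefinite matrix. Let $$\bar x_{k+1}=\frac{\sum_{i=1}^kN_i\,x_{i+1}}{\sum_{i=1}^kN_i}\qquad(k\ge 1).$$ Then, for every $k\ge1$, all entries of $(\bar x_{k+1}-x^*)(\bar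 x_{k+1}-x^*)^T$ are integrable, and $$E\big[(\bar x_{k+1}-x^*)(\bar x_{k+1}-x^*)^T\big]\sim\frac{S^{-1}\Sigma^2S^{-1}}{\sum_{i=1}^kN_i}\quad(k\to\infty),$$ in the sense that $\big(\sum_{i=1}^kN_i\big)\,E\big[(\bar x_{k+1}-x^*)(\bar x_{k+1}-x^*)^T\big]\to S^{-1}\Sigma^2S^{-1}$. The limit does not depend on $D$, $c$ or $\alpha$. -/

import Mathlib

open MeasureTheory Filter Topology Set

noncomputable section

namespace IncreasingPrecision

/-- The Hessian matrix of `f` at `x` in the standard basis: the `(i, j)` entry is the `j`-th partial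
derivative of the `i`-th coordinate of the gradient. -/
def hessian {n : ℕ} (f : EuclideanSpace ℝ (Fin n) → ℝ) (x : EuclideanSpace ℝ (Fin n)) :
    Matrix (Fin n) (Fin n) ℝ :=
  Matrix.of fun i j => (fderiv ℝ (gradient f) x (EuclideanSpace.single j (1 : ℝ))) i

/-- The operator norm of a square matrix induced by the Euclidean norm. -/
def l2Norm {n : ℕ} (A : Matrix (Fin n) (Fin n) ℝ) : ℝ :=
  ‖Matrix.toEuclideanCLM (𝕜 := ℝ) A‖

/-- `xs` is the only critical point of `f`, and the Hessian of `f` exists everywhere, is positive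
definite, and is bounded together with its inverse. -/
structure ConvexityAssumption {n : ℕ} (f : EuclideanSpace ℝ (Fin n) → ℝ)
    (xs : EuclideanSpace ℝ (Fin n)) : Prop where
  differentiable : Differentiable ℝ f
  critical_iff : ∀ x, gradient f x = 0 ↔ x = xs
  differentiable_gradient : Differentiable ℝ (gradient f)
  posDef : ∀ x, (hessian f x).PosDef
  bounded : BddAbove (range fun x => l2Norm (hessian f x))
  bounded_inv : BddAbove (range fun x => l2Norm (hessian f x)⁻¹)

/-- The process `x_{k+1} = x_k - A_k (∇f(x_k) + ε_k)`, `k ≥ 1`, with `x_1` being `ℱ_0`-measurable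
and square integrable, where the noise `ε_k` is `ℱ_k`-measurable, integrable, has conditional
mean zero given `ℱ_{k-1}`, and has a conditional law given `ℱ_{k-1}` that depends only on `x_k`
(and `k`). Only the indices `k ≥ 1` of `x`, `A` and `ε` matter. -/
structure IsProcess {n : ℕ} {Ω : Type*} {mΩ : MeasurableSpace Ω} (P : Measure Ω)
    (ℱ : Filtration ℕ mΩ) (f : EuclideanSpace ℝ (Fin n) → ℝ)
    (A : ℕ → Matrix (Fin n) (Fin n) ℝ) (ε x : ℕ → Ω → EuclideanSpace ℝ (Fin n)) : Prop where
  initial_measurable : StronglyMeasurable[ℱ 0] (x 1)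
  initial_memLp : MemLp (x 1) 2 P
  update : ∀ k ≥ 1, ∀ ω,
    x (k + 1) ω = x k ω - Matrix.toEuclideanCLM (𝕜 := ℝ) (A k) (gradient f (x k ω) + ε k ω)
  noise_measurable : ∀ k ≥ 1, StronglyMeasurable[ℱ k] (ε k)
  noise_integrable : ∀ k ≥ 1, Integrable (ε k) P
  noise_mean_zero : ∀ k ≥ 1, P[ε k | ℱ (k - 1)] =ᵐ[P] 0
  noise_law : ∀ k ≥ 1, ∀ g : EuclideanSpace ℝ (Fin n) → ℝ, Measurable g →
    Integrable (fun ω => g (ε k ω)) P →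
    P[fun ω => g (ε k ω) | ℱ (k - 1)] =ᵐ[P]
      P[fun ω => g (ε k ω) | MeasurableSpace.comap (x k) inferInstance]

/-- `sup_k N_k^{p/2} E[‖ε_k‖^p | ℱ_{k-1}]` is finite (as an essential supremum) for every
integer `p ∈ {2, …, M}`. -/
def MomentAssumption {n : ℕ} {Ω : Type*} {mΩ : MeasurableSpace Ω} (P : Measure Ω)
    (ℱ : Filtration ℕ mΩ) (N : ℕ → ℝ) (ε : ℕ → Ω → EuclideanSpace ℝ (Fin n)) (M : ℕ) : Prop :=
  ∀ p : ℕ, 2 ≤ p → p ≤ M → ∃ C : ℝ, ∀ k ≥ 1,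
    Integrable (fun ω => ‖ε k ω‖ ^ p) P ∧
    ∀ᵐ ω ∂P, N k ^ ((p : ℝ) / 2) * (P[fun ω' => ‖ε k ω'‖ ^ p | ℱ (k - 1)]) ω ≤ C

/-- `N` is positive, nondecreasing, and asymptotic to `N₁ k^q` for some constant `N₁ > 0`. -/
structure SampleSizeAssumption (N : ℕ → ℝ) (q : ℝ) : Prop where
  pos : ∀ k ≥ 1, 0 < N k
  mono : ∀ k ≥ 1, N k ≤ N (k + 1)
  equivalent : ∃ N₁ : ℝ, 0 < N₁ ∧
    Asymptotics.IsEquivalent atTop N (fun k : ℕ => N₁ * (k : ℝ) ^ q)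

/-- `U k` is a version of the conditional second moment `x ↦ E[ε_k ε_kᵀ | x_k = x]`. -/
def IsConditionalCovariance {n : ℕ} {Ω : Type*} {mΩ : MeasurableSpace Ω} (P : Measure Ω)
    (ε x : ℕ → Ω → EuclideanSpace ℝ (Fin n))
    (U : ℕ → EuclideanSpace ℝ (Fin n) → Matrix (Fin n) (Fin n) ℝ) : Prop :=
  ∀ k ≥ 1, ∀ i j, Measurable (fun y => U k y i j) ∧
    (fun ω => U k (x k ω) i j) =ᵐ[P]
      P[fun ω => ε k ω i * ε k ω j | MeasurableSpace.comap (x k) inferInstance]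

/-- On a neighbourhood `V` of `xs`, the limit `Ut(y) = lim_k N_k E[ε_k ε_kᵀ | x_k = y]` exists
uniformly and is continuous, and `Ut(xs) = Sig2` is a positive (semidefinite) matrix. -/
def CovarianceAssumption {n : ℕ} {Ω : Type*} {mΩ : MeasurableSpace Ω} (P : Measure Ω)
    (N : ℕ → ℝ) (ε x : ℕ → Ω → EuclideanSpace ℝ (Fin n)) (xs : EuclideanSpace ℝ (Fin n))
    (Sig2 : Matrix (Fin n) (Fin n) ℝ) : Prop :=
  Sig2.PosSemidef ∧
  ∃ U : ℕ → EuclideanSpace ℝ (Fin n) → Matrix (Fin n) (Fin n) ℝ,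
    IsConditionalCovariance P ε x U ∧
    ∃ Ut : EuclideanSpace ℝ (Fin n) → Matrix (Fin n) (Fin n) ℝ, ∃ V ∈ 𝓝 xs,
      (∀ i j, TendstoUniformlyOn (fun k y => N k * U k y i j) (fun y => Ut y i j) atTop V) ∧
      ContinuousOn Ut V ∧ Ut xs = Sig2

/-- The weighted average `x̄_{k+1} = (∑_{i=1}^k N_i x_{i+1}) / ∑_{i=1}^k N_i`. -/
def averagedNext {n : ℕ} {Ω : Type*} (N : ℕ → ℝ) (x : ℕ → Ω → EuclideanSpace ℝ (Fin n))
    (k : ℕ) (ω : Ω) : EuclideanSpace ℝ (Fin n) :=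
  (∑ i ∈ Finset.Icc 1 k, N i)⁻¹ • ∑ i ∈ Finset.Icc 1 k, N i • x (i + 1) ω

/-- The matrix `E[(X - xs)(X - xs)ᵀ]`. -/
def secondMoment {n : ℕ} {Ω : Type*} {mΩ : MeasurableSpace Ω} (P : Measure Ω)
    (X : Ω → EuclideanSpace ℝ (Fin n)) (xs : EuclideanSpace ℝ (Fin n)) :
    Matrix (Fin n) (Fin n) ℝ :=
  Matrix.of fun i j => ∫ ω, (X ω - xs) i * (X ω - xs) j ∂P

end IncreasingPrecision

end

/-! Write `e_k = x_k - xs`, `S` for the Hessian at `xs`, `W_k = ∑_{i ≤ k} N_i`, and `ρ(v) = ∇f(xs +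
v) - S v`. Solving the update for the linear part of the drift gives `S e_k = (k+c)^α D⁻¹(e_k -
e_{k+1}) - ρ(e_k) - ε_k`. Summing with weights `N_i` at index `i+1` expresses `S ∑ N_i e_{i+1}` as a
near-telescoping sum, minus a nonlinear sum, minus the noise sum `∑ N_i ε_{i+1}`.

The noise sum has orthogonal increments, so its second moment is `∑ N_i² E[ε_{i+1} ε_{i+1}ᵀ]`
(`integral_weighted_noise_sum_mul`). By `tendsto_noise_covariance` and `N_i / N_{i+1} → 1` this is
asymptotic to `W_k Σ²`, and applying `S⁻¹` on both sides gives the limit. The other two sums are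
`o(√W_k)` in `L²` (`tendsto_remainder`), hence invisible by Cauchy–Schwarz
(`tendsto_integral_mul_of_perturbation`). The gain `D`, `c`, `α` occurs only in these negligible
terms, which is why the limit does not see it.

Both negligible sums rest on rates for the unaveraged iterates. Abel summation together with
`E‖e_k‖² = O(k^{-(α+q)})` bounds the first by a multiple of `√(N_k k^α)`, which is `o(√W_k)` because
`α < 1`. The second needs `E‖ρ(e_k)‖² = O(k^{-s})` with `s > q + 1`. Since `ρ` is bounded both
linearly and quadratically, `‖ρ(v)‖² ≤ C ‖v‖^p` for `p = 3, 4`, and a `p`-th moment rate gives `s =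
(α+q)p/2`; `exists_moment_order` picks `p`.

The moment rates (`exists_moment_bound`) come from a contraction recursion in the coordinates
`D^{-1/2} e_k`, in which the drift is strongly monotone. As `x_1` has only two moments, they are
proved on `ℱ 0`-measurable events with constants independent of the event, and
`exists_truncated_moment_bound` then truncates `x_1` at a level growing with `k`. -/

namespace IncreasingPrecision

/-! ### Elementary inequalities and a deterministic recursion -/

section Deterministic

/-- The first-order term is kept exact because it vanishes in expectation when `h` is conditionally
centred noise; everything else is of second order or higher in `h`. -/
theorem norm_add_pow_le {E : Type*} [NormedAddCommGroup E] [InnerProductSpace ℝ E] {p : ℕ}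
    (hp : p = 2 ∨ p = 3 ∨ p = 4) (u h : E) :
    ‖u + h‖ ^ p ≤ ‖u‖ ^ p + p * (‖u‖ ^ (p - 2) * inner ℝ u h)
      + 11 * (‖u‖ ^ (p - 2) * ‖h‖ ^ 2 + ‖h‖ ^ p) := by
  have hsq : ‖u + h‖ ^ 2 = ‖u‖ ^ 2 + 2 * inner ℝ u h + ‖h‖ ^ 2 := norm_add_sq_real u h
  have hin : |inner ℝ u h| ≤ ‖u‖ * ‖h‖ := abs_real_inner_le_norm u h
  have htri : ‖u + h‖ ≤ ‖u‖ + ‖h‖ := norm_add_le u h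
  have hs := norm_nonneg (u + h)
  have ht := norm_nonneg u
  have hh := norm_nonneg h
  generalize inner ℝ u h = y at *
  generalize ‖u + h‖ = s at *
  generalize ‖u‖ = t at *
  generalize ‖h‖ = r at *
  obtain ⟨hy1, hy2⟩ := abs_le.mp hin
  rcases hp with rfl | rfl | rfl
  · norm_num
    nlinarith [sq_nonneg r]
  · norm_num
    rcases le_or_gt r t with hrt | hrt
    · rcases ht.eq_or_lt with rfl | htpos
      · have hr0 : r = 0 := le_antisymm hrt hh
        subst hr0
        have : s = 0 := by nlinarith
        simp [this]
      -- The odd power is traded by AM-GM for a polynomial in `s ^ 2`, the only quantity with an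
      -- exact expansion.
      · have h1 : 2 * t * s ≤ s ^ 2 + t ^ 2 := by nlinarith [sq_nonneg (s - t)]
        have h2 : 2 * t * s ^ 3 ≤ s ^ 2 * (s ^ 2 + t ^ 2) := by
          nlinarith [mul_le_mul_of_nonneg_left h1 (sq_nonneg s)]
        have hd : (2 * y + r ^ 2) ^ 2 ≤ 9 * t ^ 2 * r ^ 2 := by
          have : |2 * y + r ^ 2| ≤ 3 * t * r := by
            rw [abs_le]; constructor <;> nlinarith
          calc (2 * y + r ^ 2) ^ 2 = |2 * y + r ^ 2| ^ 2 := (sq_abs _).symm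
            _ ≤ (3 * t * r) ^ 2 := by gcongr
            _ = _ := by ring
        have h3 : 2 * t * s ^ 3 ≤ 2 * t * (t ^ 3 + 3 * (t * y) + 11 * (t * r ^ 2 + r ^ 3)) := by
          rw [hsq] at h2
          have : 0 ≤ t * r ^ 3 := by positivity
          have : 0 ≤ t ^ 2 * r ^ 2 := by positivity
          nlinarith
        exact le_of_mul_le_mul_left h3 (by positivity)
    -- Origin of the constant `11 = 8 + 3`: if `h` dominates, the left side is at most `8 r³`, while
    -- the linear term may be as low as `-3 r³`.
    · have h1 : s ^ 3 ≤ (2 * r) ^ 3 := by gcongr; linarith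
      have h2 : -(r ^ 3) ≤ t * y := by
        have : t * (t * r) ≤ r * (r * r) := by gcongr
        nlinarith
      have h3 : 0 ≤ t ^ 3 := by positivity
      have h4 : 0 ≤ t * r ^ 2 := by positivity
      nlinarith
  · norm_num
    have e : s ^ 4 = (s ^ 2) ^ 2 := by ring
    rw [e, hsq]
    have hy3 : y ^ 2 ≤ t ^ 2 * r ^ 2 := by
      calc y ^ 2 = |y| ^ 2 := (sq_abs _).symm
        _ ≤ (t * r) ^ 2 := by gcongr
        _ = _ := by ring
    have hyr : y * r ^ 2 ≤ (t * r) * r ^ 2 := by gcongr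
    have hq : 2 * ((t * r) * r ^ 2) ≤ t ^ 2 * r ^ 2 + r ^ 4 := by
      nlinarith [sq_nonneg (t * r - r ^ 2)]
    have : 0 ≤ r ^ 4 := by positivity
    have : 0 ≤ t ^ 2 * r ^ 2 := by positivity
    nlinarith

/-- A Young inequality obtained by comparing `s` with `δ t`. The small factor `δ` lets the mixed
noise term be absorbed into the contraction. -/
theorem pow_mul_sq_le (p : ℕ) (hp : 2 ≤ p) {δ : ℝ} (hδ : 0 < δ) (hδ1 : δ ≤ 1) {t s : ℝ}
    (ht : 0 ≤ t) (hs : 0 ≤ s) :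
    t ^ (p - 2) * s ^ 2 ≤ δ * t ^ p + (1 / δ) ^ (p - 2) * s ^ p := by
  have hsplit : ∀ v : ℝ, v ^ p = v ^ (p - 2) * v ^ 2 := fun v => by
    rw [← pow_add, Nat.sub_add_cancel hp]
  rcases le_or_gt s (δ * t) with h | h
  · have h1 : s ^ 2 ≤ δ * t ^ 2 := by
      calc s ^ 2 ≤ (δ * t) ^ 2 := by gcongr
        _ = δ * (δ * t ^ 2) := by ring
        _ ≤ δ * (1 * t ^ 2) := by gcongr
        _ = δ * t ^ 2 := by ring
    calc t ^ (p - 2) * s ^ 2 ≤ t ^ (p - 2) * (δ * t ^ 2) := by gcongr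
      _ = δ * t ^ p := by rw [hsplit t]; ring
      _ ≤ _ := le_add_of_nonneg_right (by positivity)
  · have h1 : t ≤ 1 / δ * s := by
      rw [one_div, inv_mul_eq_div, le_div_iff₀ hδ]; linarith
    calc t ^ (p - 2) * s ^ 2 ≤ (1 / δ * s) ^ (p - 2) * s ^ 2 := by gcongr
      _ = (1 / δ) ^ (p - 2) * s ^ p := by rw [hsplit s, mul_pow]; ring
      _ ≤ _ := le_add_of_nonneg_left (by positivity)

theorem rpow_add_const_neg_ge {α c : ℝ} (hα : 0 ≤ α) (hc : 0 ≤ c) {k : ℕ} (hk : 1 ≤ k) :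
    (1 + c) ^ (-α) * (k : ℝ) ^ (-α) ≤ ((k : ℝ) + c) ^ (-α) := by
  have hk' : (1 : ℝ) ≤ k := by exact_mod_cast hk
  rw [← Real.mul_rpow (by positivity) (by positivity)]
  apply Real.rpow_le_rpow_of_nonpos (by positivity) _ (by linarith)
  nlinarith

theorem rpow_add_const_neg_le {α c : ℝ} (hα : 0 ≤ α) (hc : 0 ≤ c) {k : ℕ} (hk : 1 ≤ k) :
    ((k : ℝ) + c) ^ (-α) ≤ (k : ℝ) ^ (-α) := by
  have hk' : (1 : ℝ) ≤ k := by exact_mod_cast hk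
  apply Real.rpow_le_rpow_of_nonpos (by positivity) _ (by linarith)
  linarith

theorem rpow_neg_le_one {α : ℝ} (hα : 0 ≤ α) {k : ℕ} (hk : 1 ≤ k) : (k : ℝ) ^ (-α) ≤ 1 :=
  Real.rpow_le_one_of_one_le_of_nonpos (by exact_mod_cast hk) (by linarith)

/-- The relative loss of `k ^ (-β)` in one step is about `β / k`, which is eventually beaten by any
multiple of the step size `(k + c) ^ (-α)` since `α < 1`. -/
theorem eventually_rpow_neg_le_succ {α c κ β : ℝ} (hα0 : 0 ≤ α) (hα : α < 1) (hc : 0 ≤ c)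
    (hκ : 0 < κ) (hβ : 0 ≤ β) :
    ∀ᶠ k : ℕ in atTop,
      (k : ℝ) ^ (-β) ≤ (1 + κ * ((k : ℝ) + c) ^ (-α)) * ((k : ℝ) + 1) ^ (-β) := by
  have h1 : Tendsto (fun k : ℕ => (k : ℝ) ^ (1 - α)) atTop atTop :=
    (tendsto_rpow_atTop (by linarith)).comp tendsto_natCast_atTop_atTop
  have hc1 : 0 < (1 + c) ^ (-α) := by positivity
  filter_upwards [h1.eventually_ge_atTop (2 * β / (κ * (1 + c) ^ (-α))), eventually_ge_atTop 1,
    tendsto_natCast_atTop_atTop.eventually_ge_atTop (2 * β)] with k hk hk1 hk2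
  have hkpos : (0 : ℝ) < k := by exact_mod_cast hk1
  have h2 : 2 * (β / k) ≤ κ * ((k : ℝ) + c) ^ (-α) := by
    have h3 := rpow_add_const_neg_ge hα0 hc hk1
    rw [div_le_iff₀ (by positivity)] at hk
    have h4 : (k : ℝ) ^ (1 - α) = k * (k : ℝ) ^ (-α) := by
      rw [sub_eq_add_neg, Real.rpow_add hkpos, Real.rpow_one]
    rw [h4] at hk
    calc 2 * (β / k) = (2 * β) / k := by ring
      _ ≤ κ * ((1 + c) ^ (-α) * (k : ℝ) ^ (-α)) := by
        rw [div_le_iff₀ hkpos]; nlinarith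
      _ ≤ _ := by gcongr
  have h5 : (((k : ℝ) + 1) / k) ^ β ≤ 1 + 2 * (β / k) := by
    have ht : β / k ≤ 1 / 2 := by rw [div_le_div_iff₀ hkpos two_pos]; linarith
    have ht0 : 0 ≤ β / k := by positivity
    calc (((k : ℝ) + 1) / k) ^ β ≤ (Real.exp (1 / k)) ^ β := by
          apply Real.rpow_le_rpow (by positivity) _ hβ
          have := Real.add_one_le_exp (1 / (k : ℝ))
          rw [add_div, div_self hkpos.ne']; linarith
      _ = Real.exp (β / k) := by rw [← Real.exp_mul]; ring_nf
      _ ≤ 1 / (1 - β / k) := Real.exp_bound_div_one_sub_of_interval ht0 (by linarith)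
      _ ≤ 1 + 2 * (β / k) := by
        rw [div_le_iff₀ (by linarith)]; nlinarith
  have h6 : (k : ℝ) ^ (-β) = (((k : ℝ) + 1) / k) ^ β * ((k : ℝ) + 1) ^ (-β) := by
    rw [Real.div_rpow (by positivity) (by positivity), Real.rpow_neg (by positivity),
      Real.rpow_neg (by positivity)]
    have : ((k : ℝ) + 1) ^ β ≠ 0 := by positivity
    field_simp
  rw [h6]
  gcongr
  linarith

theorem tendsto_rpow_add_const_neg {α c : ℝ} (hα : 0 < α) :
    Tendsto (fun k : ℕ => ((k : ℝ) + c) ^ (-α)) atTop (𝓝 0) :=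
  (tendsto_rpow_neg_atTop hα).comp
    (tendsto_atTop_add_const_right _ _ tendsto_natCast_atTop_atTop)

/-- The right-hand side is a supersolution of the recursion: contraction at rate `k ^ (-α)` outpaces
every polynomial decay, so the initial value is forgotten at any prescribed order `L`. That `K` is
chosen before `m` and `B` gives the uniformity over events used later. -/
theorem exists_bound_of_recursion {α c μ β L Λ : ℝ} (hα0 : 0 < α) (hα : α < 1) (hc : 0 ≤ c)
    (hμ : 0 < μ) (hβ : 0 ≤ β) (hL : β ≤ L) (hΛ : 0 ≤ Λ) (k₀ : ℕ) :
    ∃ K : ℝ, 0 ≤ K ∧ ∀ (m : ℕ → ℝ) (B : ℝ), 0 ≤ B → (∀ k ≥ 1, 0 ≤ m k) →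
      (∀ k ≥ 1, m (k + 1) ≤ Λ * (m k + B)) →
      (∀ k ≥ 1, k₀ ≤ k → m (k + 1) ≤ (1 - μ * ((k : ℝ) + c) ^ (-α)) * m k
        + B * (((k : ℝ) + c) ^ (-α) * (k : ℝ) ^ (-β))) →
      ∀ k ≥ 1, m k ≤ K * (B * (k : ℝ) ^ (-β) + m 1 * (k : ℝ) ^ (-L)) := by
  have hμ2 : 0 < μ / 2 := by positivity
  have hL0 : 0 ≤ L := hβ.trans hL
  have hsmall : ∀ᶠ k : ℕ in atTop, ((k : ℝ) + c) ^ (-α) < 1 / μ :=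
    (tendsto_rpow_add_const_neg hα0).eventually (gt_mem_nhds (by positivity))
  obtain ⟨k₁, hk₁⟩ := eventually_atTop.mp
    ((eventually_rpow_neg_le_succ hα0.le hα hc hμ2 hβ).and
      ((eventually_rpow_neg_le_succ hα0.le hα hc hμ2 hL0).and hsmall))
  set k₂ := max (max k₀ k₁) 1 with hk₂
  have hk₂1 : 1 ≤ k₂ := le_max_right _ _
  have hk₂pos : (0 : ℝ) < k₂ := by exact_mod_cast hk₂1
  -- The first summand covers the indices up to `k₂` through the crude growth bound; the second
  -- makes `K * (μ / 2)` at least `1 + μ / 2`, which absorbs the forcing term.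
  set K : ℝ := (Λ + 1) ^ k₂ * (k₂ : ℝ) ^ L + (2 / μ) * (1 + μ / 2) with hK
  have hK0 : 0 ≤ K := by positivity
  refine ⟨K, hK0, fun m B hB hm hcrude hrec => ?_⟩
  have hm1 := hm 1 le_rfl
  have hearly : ∀ k ≥ 1, m k + B ≤ (Λ + 1) ^ k * (m 1 + B) := by
    intro k hk
    induction k, hk using Nat.le_induction with
    | base => nlinarith
    | succ k hk ih =>
      have h1 := hcrude k hk
      have h2 := hm k hk
      calc m (k + 1) + B ≤ (Λ + 1) * (m k + B) := by nlinarith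
        _ ≤ (Λ + 1) * ((Λ + 1) ^ k * (m 1 + B)) := by gcongr
        _ = _ := by ring
  have hsm : ∀ k ≥ 1, k ≤ k₂ → m k ≤ K * (B * (k : ℝ) ^ (-β) + m 1 * (k : ℝ) ^ (-L)) := by
    intro k hk hkk
    have hkpos : (0 : ℝ) < k := by exact_mod_cast hk
    have hk1' : (1 : ℝ) ≤ k := by exact_mod_cast hk
    have hkk' : (k : ℝ) ≤ k₂ := by exact_mod_cast hkk
    have h1 : m k ≤ (Λ + 1) ^ k₂ * (m 1 + B) := by
      have := hearly k hk
      have h3 : (Λ + 1) ^ k ≤ (Λ + 1) ^ k₂ := pow_le_pow_right₀ (by linarith) hkk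
      calc m k ≤ m k + B := by linarith
        _ ≤ (Λ + 1) ^ k * (m 1 + B) := this
        _ ≤ _ := by gcongr
    have h2 : 1 ≤ (k₂ : ℝ) ^ L * (k : ℝ) ^ (-L) := by
      rw [Real.rpow_neg hkpos.le, ← div_eq_mul_inv, one_le_div (by positivity)]
      gcongr
    have h4 : (k : ℝ) ^ (-L) ≤ (k : ℝ) ^ (-β) :=
      Real.rpow_le_rpow_of_exponent_le hk1' (by linarith)
    calc m k ≤ (Λ + 1) ^ k₂ * (m 1 + B) * 1 := by linarith
      _ ≤ (Λ + 1) ^ k₂ * (m 1 + B) * ((k₂ : ℝ) ^ L * (k : ℝ) ^ (-L)) := by gcongr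
      _ = (Λ + 1) ^ k₂ * (k₂ : ℝ) ^ L * (B * (k : ℝ) ^ (-L) + m 1 * (k : ℝ) ^ (-L)) := by ring
      _ ≤ K * (B * (k : ℝ) ^ (-β) + m 1 * (k : ℝ) ^ (-L)) := by
        gcongr
        rw [hK]; exact le_add_of_nonneg_right (by positivity)
  intro k hk
  induction k, hk using Nat.le_induction with
  | base => exact hsm 1 le_rfl hk₂1
  | succ k hk ih =>
    rcases le_or_gt (k + 1) k₂ with hkk | hkk
    · exact hsm _ (by omega) hkk
    · have hkk1 : k₁ ≤ k := by omega
      obtain ⟨hb, hl, ha⟩ := hk₁ k hkk1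
      have hr := hrec k hk (by omega)
      have hkpos : (0 : ℝ) < k := by exact_mod_cast hk
      have ha0 : 0 ≤ ((k : ℝ) + c) ^ (-α) := by positivity
      have ha1 : ((k : ℝ) + c) ^ (-α) ≤ 1 :=
        (rpow_add_const_neg_le hα0.le hc hk).trans (rpow_neg_le_one hα0.le hk)
      rw [lt_div_iff₀ hμ] at ha
      push_cast
      set a := ((k : ℝ) + c) ^ (-α)
      have hb0 : 0 ≤ ((k : ℝ) + 1) ^ (-β) := by positivity
      have hl0 : 0 ≤ ((k : ℝ) + 1) ^ (-L) := by positivity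
      set b' := ((k : ℝ) + 1) ^ (-β)
      set l' := ((k : ℝ) + 1) ^ (-L)
      set b := (k : ℝ) ^ (-β)
      set l := (k : ℝ) ^ (-L)
      have hc1 : 0 ≤ 1 - μ * a := by linarith
      -- Half of the contraction pays for moving from `k` to `k + 1`; the other half is kept for the
      -- forcing term.
      have hbb : (1 - μ * a) * b ≤ (1 - μ / 2 * a) * b' := by
        calc (1 - μ * a) * b ≤ (1 - μ * a) * ((1 + μ / 2 * a) * b') := by gcongr
          _ = (1 - μ / 2 * a) * b' - μ ^ 2 / 2 * (a ^ 2 * b') := by ring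
          _ ≤ _ := sub_le_self _ (by positivity)
      have hll : (1 - μ * a) * l ≤ l' := by
        calc (1 - μ * a) * l ≤ (1 - μ * a) * ((1 + μ / 2 * a) * l') := by gcongr
          _ = l' - (μ / 2 * a * l' + μ ^ 2 / 2 * (a ^ 2 * l')) := by ring
          _ ≤ _ := sub_le_self _ (by positivity)
      have hb1 : b ≤ (1 + μ / 2) * b' := by
        refine hb.trans ?_
        gcongr
        nlinarith
      have hKμ : 1 + μ / 2 ≤ K * (μ / 2) := by
        have : (2 / μ) * (1 + μ / 2) ≤ K := by
          rw [hK]; exact le_add_of_nonneg_left (by positivity)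
        calc 1 + μ / 2 = (2 / μ) * (1 + μ / 2) * (μ / 2) := by field_simp
          _ ≤ _ := by gcongr
      calc m (k + 1) ≤ (1 - μ * a) * m k + B * (a * b) := hr
        _ ≤ (1 - μ * a) * (K * (B * b + m 1 * l)) + B * (a * ((1 + μ / 2) * b')) := by gcongr
        _ = K * (B * ((1 - μ * a) * b) + m 1 * ((1 - μ * a) * l))
            + B * a * b' * (1 + μ / 2) := by ring
        _ ≤ K * (B * ((1 - μ / 2 * a) * b') + m 1 * l') + B * a * b' * (K * (μ / 2)) := by
          gcongr
        _ = K * (B * b' + m 1 * l') := by ring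

end Deterministic

/-! ### Moment rates for a strongly monotone stochastic recursion -/

section Moments

theorem integral_mul_le_of_condExp_le {Ω : Type*} {m mΩ : MeasurableSpace Ω} {P : Measure Ω}
    [IsFiniteMeasure P] (hm : m ≤ mΩ)
    {Y W : Ω → ℝ} (hY : StronglyMeasurable[m] Y) (hY0 : ∀ ω, 0 ≤ Y ω) (hYi : Integrable Y P)
    (hW : Integrable W P) (hYW : Integrable (fun ω => Y ω * W ω) P) {κ : ℝ}
    (hle : ∀ᵐ ω ∂P, (P[W | m]) ω ≤ κ) :
    ∫ ω, Y ω * W ω ∂P ≤ κ * ∫ ω, Y ω ∂P := by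
  have h1 : P[Y * W | m] =ᵐ[P] Y * P[W | m] :=
    condExp_mul_of_stronglyMeasurable_left hY hYW hW
  rw [← integral_condExp hm (f := fun ω => Y ω * W ω), ← integral_const_mul]
  refine integral_mono_ae integrable_condExp (hYi.const_mul κ) ?_
  filter_upwards [h1, hle] with ω hω hκ
  change (P[Y * W | m]) ω ≤ _
  rw [hω, Pi.mul_apply, mul_comm κ]
  exact mul_le_mul_of_nonneg_left hκ (hY0 ω)

theorem integral_inner_eq_zero {Ω : Type*} {m mΩ : MeasurableSpace Ω} {P : Measure Ω}
    [IsFiniteMeasure P] {E : Type*} [NormedAddCommGroup E]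
    [InnerProductSpace ℝ E] [CompleteSpace E] (hm : m ≤ mΩ)
    {Y ξ : Ω → E} (hY : StronglyMeasurable[m] Y) (hξ : Integrable ξ P)
    (hYξ : Integrable (fun ω => inner ℝ (Y ω) (ξ ω)) P) (h0 : P[ξ | m] =ᵐ[P] 0) :
    ∫ ω, inner ℝ (Y ω) (ξ ω) ∂P = 0 := by
  have h1 := condExp_bilin_of_stronglyMeasurable_left (innerSL ℝ) hY hYξ hξ
  rw [← integral_condExp hm (f := fun ω => inner ℝ (Y ω) (ξ ω))]
  refine integral_eq_zero_of_ae ?_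
  filter_upwards [h1, h0] with ω hω h0ω
  refine hω.trans ?_
  rw [h0ω]; simp

/-- Expand by `norm_add_pow_le`, drop the centred linear term, and pull the `m`-measurable power of
`u` out of the conditional second moment of the noise. Working on `S` asks for integrability of `‖u‖
^ p` there only. -/
theorem integral_norm_sub_smul_pow_le {Ω : Type*} {m mΩ : MeasurableSpace Ω} {P : Measure Ω}
    [IsProbabilityMeasure P] {E : Type*} [NormedAddCommGroup E]
    [InnerProductSpace ℝ E] [CompleteSpace E] {p : ℕ} (hp : p = 2 ∨ p = 3 ∨ p = 4)
    (hm : m ≤ mΩ) {S : Set Ω} (hS : MeasurableSet[m] S) {u ξ : Ω → E}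
    (hu : StronglyMeasurable[m] u) (hup : IntegrableOn (fun ω => ‖u ω‖ ^ p) S P)
    (hξ : Integrable ξ P) (hξ0 : P[ξ | m] =ᵐ[P] 0)
    (hξ2 : Integrable (fun ω => ‖ξ ω‖ ^ 2) P) (hξp : Integrable (fun ω => ‖ξ ω‖ ^ p) P)
    {κ₂ κ : ℝ} (hκ₂ : ∀ᵐ ω ∂P, (P[fun ω => ‖ξ ω‖ ^ 2 | m]) ω ≤ κ₂)
    (hκ : ∀ᵐ ω ∂P, (P[fun ω => ‖ξ ω‖ ^ p | m]) ω ≤ κ) {a : ℝ} (ha : 0 ≤ a) :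
    IntegrableOn (fun ω => ‖u ω‖ ^ (p - 2)) S P ∧
    IntegrableOn (fun ω => ‖u ω - a • ξ ω‖ ^ p) S P ∧
    ∫ ω in S, ‖u ω - a • ξ ω‖ ^ p ∂P ≤ ∫ ω in S, ‖u ω‖ ^ p ∂P
      + 11 * (a ^ 2 * (κ₂ * ∫ ω in S, ‖u ω‖ ^ (p - 2) ∂P) + a ^ p * (κ * P.real S)) := by
  have hp2 : 2 ≤ p := by omega
  have hS' : MeasurableSet S := hm S hS
  have huP : AEStronglyMeasurable u P := (hu.mono hm).aestronglyMeasurable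
  have hξm := hξ.aestronglyMeasurable
  have hY : IntegrableOn (fun ω => ‖u ω‖ ^ (p - 2)) S P := by
    refine ((integrable_const (1 : ℝ)).integrableOn.add hup).mono'
      (huP.norm.pow _).restrict (ae_of_all _ fun ω => ?_)
    have := pow_mul_sq_le p hp2 one_pos le_rfl (norm_nonneg (u ω)) zero_le_one
    simp only [one_pow, one_div, inv_one, mul_one, one_mul] at this
    rw [Real.norm_of_nonneg (by positivity), Pi.add_apply]
    linarith
  have hYW : IntegrableOn (fun ω => ‖u ω‖ ^ (p - 2) * ‖ξ ω‖ ^ 2) S P := by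
    refine (hup.add hξp.integrableOn).mono'
      ((huP.norm.pow _).mul (hξm.norm.pow _)).restrict (ae_of_all _ fun ω => ?_)
    have := pow_mul_sq_le p hp2 one_pos le_rfl (norm_nonneg (u ω)) (norm_nonneg (ξ ω))
    simp only [one_pow, one_div, inv_one, one_mul] at this
    rw [Real.norm_of_nonneg (by positivity), Pi.add_apply]
    exact this
  have hin : IntegrableOn (fun ω => inner ℝ (‖u ω‖ ^ (p - 2) • u ω) (ξ ω)) S P := by
    refine (hup.add hYW).mono'
      (((huP.norm.pow _).smul huP).inner hξm).restrict (ae_of_all _ fun ω => ?_)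
    have h1 : ‖inner ℝ (‖u ω‖ ^ (p - 2) • u ω) (ξ ω)‖ ≤ ‖u ω‖ ^ (p - 2) * (‖u ω‖ * ‖ξ ω‖) := by
      refine (norm_inner_le_norm _ _).trans (le_of_eq ?_)
      rw [norm_smul, norm_pow, norm_norm]; ring
    have h2 : ‖u ω‖ * ‖ξ ω‖ ≤ ‖u ω‖ ^ 2 + ‖ξ ω‖ ^ 2 := by
      nlinarith [sq_nonneg (‖u ω‖ - ‖ξ ω‖), sq_nonneg (‖u ω‖), sq_nonneg ‖ξ ω‖]
    have h3 : ‖u ω‖ ^ p = ‖u ω‖ ^ (p - 2) * ‖u ω‖ ^ 2 := by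
      rw [← pow_add, Nat.sub_add_cancel hp2]
    calc _ ≤ _ := h1
      _ ≤ ‖u ω‖ ^ (p - 2) * (‖u ω‖ ^ 2 + ‖ξ ω‖ ^ 2) := by gcongr
      _ = _ := by rw [Pi.add_apply, h3]; ring
  have hin0 : ∫ ω in S, inner ℝ (‖u ω‖ ^ (p - 2) • u ω) (ξ ω) ∂P = 0 := by
    rw [← integral_indicator hS']
    have e : (S.indicator fun ω => inner ℝ (‖u ω‖ ^ (p - 2) • u ω) (ξ ω)) =
        fun ω => inner ℝ (S.indicator (fun ω => ‖u ω‖ ^ (p - 2) • u ω) ω) (ξ ω) := by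
      ext ω; by_cases h : ω ∈ S <;> simp [h]
    rw [e]
    refine integral_inner_eq_zero hm (((hu.norm.pow _).smul hu).indicator hS) hξ ?_ hξ0
    rw [← e]; exact hin.integrable_indicator hS'
  have hW2 : ∫ ω in S, ‖u ω‖ ^ (p - 2) * ‖ξ ω‖ ^ 2 ∂P
      ≤ κ₂ * ∫ ω in S, ‖u ω‖ ^ (p - 2) ∂P := by
    rw [← integral_indicator hS', ← integral_indicator hS']
    have e : (S.indicator fun ω => ‖u ω‖ ^ (p - 2) * ‖ξ ω‖ ^ 2) =
        fun ω => S.indicator (fun ω => ‖u ω‖ ^ (p - 2)) ω * ‖ξ ω‖ ^ 2 := by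
      ext ω; by_cases h : ω ∈ S <;> simp [h]
    rw [e]
    have hYm : StronglyMeasurable[m] (S.indicator fun ω => ‖u ω‖ ^ (p - 2)) :=
      (hu.norm.pow _).indicator hS
    refine integral_mul_le_of_condExp_le hm hYm
      (fun ω => indicator_nonneg (fun _ _ => by positivity) _) (hY.integrable_indicator hS')
      hξ2 ?_ hκ₂
    rw [← e]; exact hYW.integrable_indicator hS'
  have hWp : ∫ ω in S, ‖ξ ω‖ ^ p ∂P ≤ κ * P.real S := by
    rw [← setIntegral_condExp hm hξp hS]
    refine (setIntegral_mono_ae integrable_condExp.integrableOn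
      (integrable_const κ).integrableOn hκ).trans (le_of_eq ?_)
    rw [setIntegral_const, smul_eq_mul, mul_comm]
  have hpt : ∀ ω, ‖u ω - a • ξ ω‖ ^ p ≤ ‖u ω‖ ^ p
      + (-(p * a)) * inner ℝ (‖u ω‖ ^ (p - 2) • u ω) (ξ ω)
      + (11 * a ^ 2 * (‖u ω‖ ^ (p - 2) * ‖ξ ω‖ ^ 2) + 11 * a ^ p * ‖ξ ω‖ ^ p) := by
    intro ω
    have := norm_add_pow_le hp (u ω) (-(a • ξ ω))
    rw [← sub_eq_add_neg, norm_neg, norm_smul, Real.norm_of_nonneg ha, inner_neg_right,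
      inner_smul_right, mul_pow, mul_pow] at this
    rw [real_inner_smul_left]
    refine this.trans (le_of_eq (by ring))
  have hI1 : IntegrableOn (fun ω => ‖u ω‖ ^ p
      + (-(p * a)) * inner ℝ (‖u ω‖ ^ (p - 2) • u ω) (ξ ω)) S P :=
    hup.add (hin.const_mul (-(p * a)))
  have hI2 : IntegrableOn (fun ω => 11 * a ^ 2 * (‖u ω‖ ^ (p - 2) * ‖ξ ω‖ ^ 2)
      + 11 * a ^ p * ‖ξ ω‖ ^ p) S P :=
    (hYW.const_mul (11 * a ^ 2)).add (hξp.integrableOn.const_mul (11 * a ^ p))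
  have hint : IntegrableOn (fun ω => ‖u ω - a • ξ ω‖ ^ p) S P :=
    (hI1.add hI2).mono' ((huP.sub (hξm.const_smul a)).norm.pow _).restrict
      (ae_of_all _ fun ω => by
        rw [Real.norm_of_nonneg (by positivity)]; exact hpt ω)
  refine ⟨hY, hint, ?_⟩
  calc ∫ ω in S, ‖u ω - a • ξ ω‖ ^ p ∂P
      ≤ ∫ ω in S, ((‖u ω‖ ^ p + (-(p * a)) * inner ℝ (‖u ω‖ ^ (p - 2) • u ω) (ξ ω))
      + (11 * a ^ 2 * (‖u ω‖ ^ (p - 2) * ‖ξ ω‖ ^ 2) + 11 * a ^ p * ‖ξ ω‖ ^ p)) ∂P :=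
        integral_mono_ae hint (Integrable.add hI1 hI2) (ae_of_all _ hpt)
    _ = ∫ ω in S, ‖u ω‖ ^ p ∂P + (11 * a ^ 2 * ∫ ω in S, ‖u ω‖ ^ (p - 2) * ‖ξ ω‖ ^ 2 ∂P
        + 11 * a ^ p * ∫ ω in S, ‖ξ ω‖ ^ p ∂P) := by
      rw [integral_add hI1 hI2, integral_add hup (hin.const_mul _),
        integral_add (hYW.const_mul _) (hξp.integrableOn.const_mul _), integral_const_mul,
        integral_const_mul, integral_const_mul, hin0]
      ring
    _ ≤ ∫ ω in S, ‖u ω‖ ^ p ∂P + (11 * a ^ 2 * (κ₂ * ∫ ω in S, ‖u ω‖ ^ (p - 2) ∂P)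
        + 11 * a ^ p * (κ * P.real S)) := by gcongr
    _ = _ := by ring

-- The drift contracts `‖z‖ ^ p` by `1 - μ a_k`, and the noise adds `O(a_k k^{-(α+q)p/2})` plus a
-- small multiple of `a_k ‖z‖ ^ p`; `exists_bound_of_recursion` then applies. `K` does not depend on
-- `S`, and `R` is a free exponent at which the initial moment is forgotten.
set_option maxHeartbeats 2000000 in
theorem exists_moment_bound {Ω : Type*} {mΩ : MeasurableSpace Ω} {P : Measure Ω}
    [IsProbabilityMeasure P] {E : Type*} [NormedAddCommGroup E]
    [InnerProductSpace ℝ E] [CompleteSpace E] {ℱ : Filtration ℕ mΩ} {z ξ : ℕ → Ω → E} {F : E → E}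
    {α c q μ l R : ℝ} {p : ℕ} (hp : p = 2 ∨ p = 3 ∨ p = 4) (hα0 : 0 < α) (hα1 : α < 1)
    (hc : 0 ≤ c) (hq : 0 ≤ q) (hR : (α + q) * p / 2 ≤ R)
    (hF : Continuous F) (hμ : 0 < μ) (hFμ : ∀ v, μ * ‖v‖ ^ 2 ≤ inner ℝ (F v) v)
    (hl : 0 ≤ l) (hFl : ∀ v, ‖F v‖ ≤ l * ‖v‖) (hz : StronglyMeasurable[ℱ 0] (z 1))
    (hup : ∀ k ≥ 1, ∀ ω, z (k + 1) ω = z k ω - ((k : ℝ) + c) ^ (-α) • (F (z k ω) + ξ k ω))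
    (hξm : ∀ k ≥ 1, StronglyMeasurable[ℱ k] (ξ k)) (hξ : ∀ k ≥ 1, Integrable (ξ k) P)
    (hξ0 : ∀ k ≥ 1, P[ξ k | ℱ (k - 1)] =ᵐ[P] 0)
    (hmom : ∀ j : ℕ, j = 2 ∨ j = p → ∃ C : ℝ, 0 ≤ C ∧ ∀ k ≥ 1,
      Integrable (fun ω => ‖ξ k ω‖ ^ j) P ∧
      ∀ᵐ ω ∂P, (P[fun ω' => ‖ξ k ω'‖ ^ j | ℱ (k - 1)]) ω ≤ C * ((k : ℝ) ^ (-(q / 2))) ^ j) :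
    ∃ K : ℝ, 0 ≤ K ∧ ∀ S : Set Ω, MeasurableSet[ℱ 0] S →
      IntegrableOn (fun ω => ‖z 1 ω‖ ^ p) S P → ∀ k ≥ 1,
      IntegrableOn (fun ω => ‖z k ω‖ ^ p) S P ∧
      ∫ ω in S, ‖z k ω‖ ^ p ∂P ≤ K * (P.real S * (k : ℝ) ^ (-((α + q) * p / 2))
        + (∫ ω in S, ‖z 1 ω‖ ^ p ∂P) * (k : ℝ) ^ (-R)) := by
  have hp2 : 2 ≤ p := by omega
  obtain ⟨C₂, hC₂, hm₂⟩ := hmom 2 (Or.inl rfl)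
  obtain ⟨C, hC, hmp⟩ := hmom p (Or.inr rfl)
  set a : ℕ → ℝ := fun k => ((k : ℝ) + c) ^ (-α) with ha
  have ha0 : ∀ k, 0 ≤ a k := fun k => by positivity
  have ha1 : ∀ k ≥ 1, a k ≤ 1 := fun k hk =>
    (rpow_add_const_neg_le hα0.le hc hk).trans (rpow_neg_le_one hα0.le hk)
  -- Chosen so that `11 * C₂ * δ ≤ μ / 2`: the mixed noise term may use up half of the contraction.
  set δ : ℝ := min 1 (μ / (22 * (C₂ + 1))) with hδ
  have hδ0 : 0 < δ := by positivity
  have hδ1 : δ ≤ 1 := min_le_left _ _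
  have hδ2 : 11 * C₂ * δ ≤ μ / 2 := by
    have : δ ≤ μ / (22 * (C₂ + 1)) := min_le_right _ _
    rw [le_div_iff₀ (by positivity)] at this
    nlinarith
  set H : ℝ := 11 * (C₂ * (1 / δ) ^ (p - 2) + C) with hH
  have hH0 : 0 ≤ H := by positivity
  -- From `k₀` on, `a_k l² ≤ μ`, so the quadratic term in `1 - 2 μ a_k + a_k² l²` costs at most half
  -- of the contraction.
  obtain ⟨k₀, hk₀⟩ := eventually_atTop.mp ((tendsto_rpow_add_const_neg (c := c) hα0).eventually
    (gt_mem_nhds (show 0 < μ / (l ^ 2 + μ ^ 2 + 1) by positivity)))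
  obtain ⟨K, hK, hKb⟩ := exists_bound_of_recursion (α := α) (c := c) (μ := μ / 2)
    (β := (α + q) * p / 2) (L := R) (Λ := (1 + 11 * C₂) * (1 + l) ^ p + 1) hα0 hα1 hc (by positivity)
    (by positivity) hR (by positivity) k₀
  refine ⟨K * (H + 1), by positivity, fun S hS hz1 => ?_⟩
  have hzm : ∀ k ≥ 1, StronglyMeasurable[ℱ (k - 1)] (z k) := by
    intro k hk
    induction k, hk using Nat.le_induction with
    | base => exact hz
    | succ k hk ih =>
      have h1 : StronglyMeasurable[ℱ k] (z k) := ih.mono (ℱ.mono (Nat.sub_le k 1))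
      rw [show z (k + 1) = fun ω => z k ω - ((k : ℝ) + c) ^ (-α) • (F (z k ω) + ξ k ω) from
        funext (hup k hk)]
      exact h1.sub (((hF.comp_stronglyMeasurable h1).add (hξm k hk)).const_smul _)
  have hcrude : ∀ k ≥ 1, ∀ v, ‖v - a k • F v‖ ≤ (1 + l) * ‖v‖ := by
    intro k hk v
    calc ‖v - a k • F v‖ ≤ ‖v‖ + a k * ‖F v‖ := by
          refine (norm_sub_le _ _).trans (le_of_eq ?_)
          rw [norm_smul, Real.norm_of_nonneg (ha0 k)]
      _ ≤ ‖v‖ + 1 * (l * ‖v‖) := by gcongr; exacts [ha1 k hk, hFl v]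
      _ = _ := by ring
  have hcontr : ∀ k ≥ 1, k₀ ≤ k → ∀ v, ‖v - a k • F v‖ ^ p ≤ (1 - μ * a k) * ‖v‖ ^ p := by
    intro k hk hkk v
    have hak := hk₀ k hkk
    rw [lt_div_iff₀ (by positivity)] at hak
    have e1 : ‖v - a k • F v‖ ^ 2 ≤ (1 - μ * a k) * ‖v‖ ^ 2 := by
      rw [norm_sub_sq_real, inner_smul_right, norm_smul, Real.norm_of_nonneg (ha0 k),
        real_inner_comm]
      have h1 := mul_le_mul_of_nonneg_left (hFμ v) (ha0 k)
      have h2 : (a k * ‖F v‖) ^ 2 ≤ (a k * (l * ‖v‖)) ^ 2 := by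
        have := ha0 k
        gcongr; exact hFl v
      have h3 : a k * l ^ 2 ≤ μ := by
        have h4 : a k * (l ^ 2 + μ ^ 2 + 1) < μ := hak
        have := ha0 k
        nlinarith [mul_nonneg this (sq_nonneg μ)]
      have h4 : a k * (a k * l ^ 2) * ‖v‖ ^ 2 ≤ a k * μ * ‖v‖ ^ 2 := by
        have := ha0 k
        gcongr
      nlinarith
    have hle1 : (1 - μ * a k) ≤ 1 := by have := ha0 k; nlinarith
    have e2 : ‖v - a k • F v‖ ≤ ‖v‖ := by
      refine le_of_sq_le_sq ?_ (norm_nonneg _)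
      nlinarith [sq_nonneg ‖v‖]
    have h3 : ∀ t : ℝ, t ^ p = t ^ (p - 2) * t ^ 2 := fun t => by
      rw [← pow_add, Nat.sub_add_cancel hp2]
    rw [h3, h3]
    calc _ ≤ ‖v‖ ^ (p - 2) * ((1 - μ * a k) * ‖v‖ ^ 2) := by gcongr
      _ = _ := by ring
  have hstep : ∀ k ≥ 1, IntegrableOn (fun ω => ‖z k ω‖ ^ p) S P →
      IntegrableOn (fun ω => ‖z (k + 1) ω‖ ^ p) S P ∧
      IntegrableOn (fun ω => ‖z k ω - a k • F (z k ω)‖ ^ p) S P ∧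
      ∫ ω in S, ‖z (k + 1) ω‖ ^ p ∂P ≤
        (1 + 11 * C₂ * δ * a k) * ∫ ω in S, ‖z k ω - a k • F (z k ω)‖ ^ p ∂P
        + H * P.real S * (a k * (k : ℝ) ^ (-((α + q) * p / 2))) := by
    intro k hk hzk
    have hkpos : (0 : ℝ) < k := by exact_mod_cast hk
    have hum : StronglyMeasurable[ℱ (k - 1)] (fun ω => z k ω - a k • F (z k ω)) :=
      (hzm k hk).sub ((hF.comp_stronglyMeasurable (hzm k hk)).const_smul _)
    have hui : IntegrableOn (fun ω => ‖z k ω - a k • F (z k ω)‖ ^ p) S P := by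
      refine (hzk.const_mul ((1 + l) ^ p)).mono'
        ((hum.mono (ℱ.le _)).norm.pow _).aestronglyMeasurable (ae_of_all _ fun ω => ?_)
      rw [Real.norm_of_nonneg (by positivity), ← mul_pow]
      have := hcrude k hk (z k ω)
      gcongr
    obtain ⟨hui2, hi, hle⟩ := integral_norm_sub_smul_pow_le hp (ℱ.le (k - 1))
      (ℱ.mono (Nat.zero_le _) S hS) hum hui (hξ k hk) (hξ0 k hk) (hm₂ k hk).1 (hmp k hk).1
      (hm₂ k hk).2 (hmp k hk).2 (ha0 k)
    have e : ∀ ω, z k ω - a k • F (z k ω) - a k • ξ k ω = z (k + 1) ω := fun ω => by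
      rw [hup k hk, smul_add, sub_sub]
    simp only [e] at hi hle
    refine ⟨hi, hui, hle.trans ?_⟩
    set τ : ℝ := (k : ℝ) ^ (-(q / 2)) with hτ
    set t : ℝ := (k : ℝ) ^ (-((α + q) / 2)) with ht
    have hτ0 : 0 ≤ τ := by positivity
    have ht0 : 0 ≤ t := by positivity
    have hat : a k * τ ^ 2 ≤ t ^ 2 := by
      have h1 : τ ^ 2 = (k : ℝ) ^ (-q) := by
        rw [hτ, ← Real.rpow_natCast, ← Real.rpow_mul hkpos.le]; congr 1; push_cast; ring
      have h2 : t ^ 2 = (k : ℝ) ^ (-α) * (k : ℝ) ^ (-q) := by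
        rw [ht, ← Real.rpow_natCast, ← Real.rpow_mul hkpos.le, ← Real.rpow_add hkpos]
        congr 1; push_cast; ring
      rw [h1, h2]
      gcongr
      exact rpow_add_const_neg_le hα0.le hc hk
    have htp : t ^ p = (k : ℝ) ^ (-((α + q) * p / 2)) := by
      rw [ht, ← Real.rpow_natCast, ← Real.rpow_mul hkpos.le]; congr 1; ring
    have haτ2 : (a k * τ) ^ 2 ≤ a k * t ^ 2 := by
      calc (a k * τ) ^ 2 = a k * (a k * τ ^ 2) := by ring
        _ ≤ _ := by have := ha0 k; gcongr
    have haτ : a k * τ ≤ t := by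
      refine le_of_sq_le_sq (haτ2.trans ?_) ht0
      have := ha1 k hk
      nlinarith [sq_nonneg t]
    have haτp : a k ^ p * τ ^ p ≤ a k * t ^ p := by
      have h3 : ∀ t : ℝ, t ^ p = t ^ (p - 2) * t ^ 2 := fun t => by
        rw [← pow_add, Nat.sub_add_cancel hp2]
      have := ha0 k
      rw [← mul_pow, h3, h3 t]
      calc _ ≤ t ^ (p - 2) * (a k * t ^ 2) := by gcongr
        _ = _ := by ring
    -- With `t = k^{-(α+q)/2}`, the natural scale of the iterate, `a_k τ² ≤ t²`; Young at this scale
    -- turns the moment of order `p - 2` into one of order `p` plus `t ^ p`.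
    have hyoung : a k * τ ^ 2 * ∫ ω in S, ‖z k ω - a k • F (z k ω)‖ ^ (p - 2) ∂P
        ≤ δ * ∫ ω in S, ‖z k ω - a k • F (z k ω)‖ ^ p ∂P + (1 / δ) ^ (p - 2) * t ^ p * P.real S := by
      calc _ ≤ t ^ 2 * ∫ ω in S, ‖z k ω - a k • F (z k ω)‖ ^ (p - 2) ∂P := by
            gcongr
        _ = ∫ ω in S, t ^ 2 * ‖z k ω - a k • F (z k ω)‖ ^ (p - 2) ∂P := by
            rw [integral_const_mul]
        _ ≤ ∫ ω in S, (δ * ‖z k ω - a k • F (z k ω)‖ ^ p + (1 / δ) ^ (p - 2) * t ^ p) ∂P := by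
            refine integral_mono_ae (hui2.const_mul _)
              ((hui.const_mul _).add (integrable_const _).integrableOn) (ae_of_all _ fun ω => ?_)
            have := pow_mul_sq_le p hp2 hδ0 hδ1 (norm_nonneg (z k ω - a k • F (z k ω))) ht0
            dsimp only
            linarith
        _ = _ := by
            rw [integral_add (hui.const_mul _) (integrable_const _).integrableOn,
              integral_const_mul, setIntegral_const, smul_eq_mul]
            ring
    rw [← htp]
    have hS0 : 0 ≤ P.real S := measureReal_nonneg
    calc _ = ∫ ω in S, ‖z k ω - a k • F (z k ω)‖ ^ p ∂P
        + (11 * (a k * C₂) * (a k * τ ^ 2 * ∫ ω in S, ‖z k ω - a k • F (z k ω)‖ ^ (p - 2) ∂P)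
          + 11 * (C * P.real S) * (a k ^ p * τ ^ p)) := by ring
      _ ≤ ∫ ω in S, ‖z k ω - a k • F (z k ω)‖ ^ p ∂P
        + (11 * (a k * C₂) * (δ * ∫ ω in S, ‖z k ω - a k • F (z k ω)‖ ^ p ∂P
            + (1 / δ) ^ (p - 2) * t ^ p * P.real S)
          + 11 * (C * P.real S) * (a k * t ^ p)) := by
        have := ha0 k
        gcongr
      _ = _ := by rw [hH]; ring
  have hall : ∀ k ≥ 1, IntegrableOn (fun ω => ‖z k ω‖ ^ p) S P := by
    intro k hk
    induction k, hk using Nat.le_induction with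
    | base => exact hz1
    | succ k hk ih => exact (hstep k hk ih).1
  have hS0 : 0 ≤ P.real S := measureReal_nonneg
  have hm0 : ∀ k, 0 ≤ ∫ ω in S, ‖z k ω‖ ^ p ∂P := fun k =>
    integral_nonneg fun ω => by positivity
  have hmain := hKb (fun k => ∫ ω in S, ‖z k ω‖ ^ p ∂P) (H * P.real S) (by positivity)
    (fun k _ => hm0 k) ?_ ?_
  · intro k hk
    refine ⟨hall k hk, (hmain k hk).trans ?_⟩
    have e1 : 0 ≤ (k : ℝ) ^ (-((α + q) * p / 2)) := by positivity
    have e2 : 0 ≤ (k : ℝ) ^ (-R) := by positivity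
    have := hm0 1
    calc _ = K * (H * (P.real S * (k : ℝ) ^ (-((α + q) * p / 2)))
          + 1 * ((∫ ω in S, ‖z 1 ω‖ ^ p ∂P) * (k : ℝ) ^ (-R))) := by ring
      _ ≤ K * ((H + 1) * (P.real S * (k : ℝ) ^ (-((α + q) * p / 2)))
          + (H + 1) * ((∫ ω in S, ‖z 1 ω‖ ^ p ∂P) * (k : ℝ) ^ (-R))) := by
        gcongr <;> linarith
      _ = _ := by ring
  · intro k hk
    obtain ⟨-, hui, hle⟩ := hstep k hk (hall k hk)
    have hu : ∫ ω in S, ‖z k ω - a k • F (z k ω)‖ ^ p ∂P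
        ≤ (1 + l) ^ p * ∫ ω in S, ‖z k ω‖ ^ p ∂P := by
      rw [← integral_const_mul]
      refine integral_mono_ae hui ((hall k hk).const_mul _) (ae_of_all _ fun ω => ?_)
      have := hcrude k hk (z k ω)
      dsimp only
      rw [← mul_pow]
      gcongr
    have e1 : (k : ℝ) ^ (-((α + q) * p / 2)) ≤ 1 := rpow_neg_le_one (by positivity) hk
    have e0 : 0 ≤ (k : ℝ) ^ (-((α + q) * p / 2)) := by positivity
    have := ha0 k
    have h1 := ha1 k hk
    have h2 := hm0 k
    calc _ ≤ _ := hle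
      _ ≤ (1 + 11 * C₂ * 1 * 1) * ((1 + l) ^ p * ∫ ω in S, ‖z k ω‖ ^ p ∂P)
          + H * P.real S * (1 * 1) := by gcongr
      _ ≤ _ := by
        have h3 : 0 ≤ (1 + 11 * C₂) * (1 + l) ^ p := by positivity
        have h4 : 0 ≤ H * P.real S := by positivity
        nlinarith [mul_nonneg h3 h4]
  · intro k hk hkk
    obtain ⟨-, hui, hle⟩ := hstep k hk (hall k hk)
    have hu : ∫ ω in S, ‖z k ω - a k • F (z k ω)‖ ^ p ∂P
        ≤ (1 - μ * a k) * ∫ ω in S, ‖z k ω‖ ^ p ∂P := by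
      rw [← integral_const_mul]
      exact integral_mono_ae hui ((hall k hk).const_mul _)
        (ae_of_all _ fun ω => hcontr k hk hkk (z k ω))
    refine hle.trans ?_
    have h0 := ha0 k
    have h2 := hm0 k
    refine add_le_add_left ?_ _
    have hu0 : 0 ≤ ∫ ω in S, ‖z k ω - a k • F (z k ω)‖ ^ p ∂P :=
      integral_nonneg fun ω => by positivity
    calc _ ≤ (1 + μ / 2 * a k) * ∫ ω in S, ‖z k ω - a k • F (z k ω)‖ ^ p ∂P :=
          mul_le_mul_of_nonneg_right
            (add_le_add_right (mul_le_mul_of_nonneg_right hδ2 h0) _) hu0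
      _ ≤ (1 + μ / 2 * a k) * ((1 - μ * a k) * ∫ ω in S, ‖z k ω‖ ^ p ∂P) :=
          mul_le_mul_of_nonneg_left hu (by positivity)
      _ = (1 - μ / 2 * a k) * (∫ ω in S, ‖z k ω‖ ^ p ∂P)
          - μ ^ 2 / 2 * (a k ^ 2 * ∫ ω in S, ‖z k ω‖ ^ p ∂P) := by ring
      _ ≤ _ := sub_le_self _ (by positivity)

end Moments

/-! ### Hessian bounds, strong monotonicity and Taylor remainder of the gradient -/

section Analysis

variable {n : ℕ}

open scoped MatrixOrder in
theorem exists_selfAdjoint_sqrt {A : Matrix (Fin n) (Fin n) ℝ} (hA : A.PosDef) :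
    ∃ Q R : EuclideanSpace ℝ (Fin n) →L[ℝ] EuclideanSpace ℝ (Fin n),
      (∀ x, Q (Q x) = Matrix.toEuclideanCLM (𝕜 := ℝ) A x) ∧
      (∀ x y, inner ℝ (Q x) y = inner ℝ x (Q y)) ∧ (∀ x, Q (R x) = x) ∧ ∀ x, R (Q x) = x := by
  have hsq : CFC.sqrt A * CFC.sqrt A = A := CFC.sqrt_mul_sqrt_self A hA.posSemidef.nonneg
  have hsa : star (CFC.sqrt A) = CFC.sqrt A :=
    (IsSelfAdjoint.of_nonneg (CFC.sqrt_nonneg A)).star_eq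
  have hu : IsUnit (CFC.sqrt A).det := by
    have h1 := hA.det_pos
    rw [← hsq, Matrix.det_mul] at h1
    exact isUnit_iff_ne_zero.mpr fun h => by simp [h] at h1
  refine ⟨Matrix.toEuclideanCLM (𝕜 := ℝ) (CFC.sqrt A),
    Matrix.toEuclideanCLM (𝕜 := ℝ) (CFC.sqrt A)⁻¹, fun x => ?_, fun x y => ?_, fun x => ?_,
    fun x => ?_⟩
  · conv_rhs => rw [← hsq, map_mul]
    rfl
  · have h := ContinuousLinearMap.adjoint_inner_left
      (Matrix.toEuclideanCLM (𝕜 := ℝ) (CFC.sqrt A)) y x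
    rwa [← ContinuousLinearMap.star_eq_adjoint, ← map_star, hsa] at h
  · have := congrArg (fun T => Matrix.toEuclideanCLM (𝕜 := ℝ) T x) (Matrix.mul_nonsing_inv _ hu)
    simpa [map_mul] using this
  · have := congrArg (fun T => Matrix.toEuclideanCLM (𝕜 := ℝ) T x) (Matrix.nonsing_inv_mul _ hu)
    simpa [map_mul] using this

/-- With `w = A⁻¹ v`, write `‖v‖² = ⟪A^{1/2} v, A^{1/2} w⟫` and apply Cauchy–Schwarz. This turns the
bound on inverse Hessians into a uniform lower bound on their quadratic forms. -/
theorem norm_sq_le_inner_mul_l2Norm_inv {A : Matrix (Fin n) (Fin n) ℝ} (hA : A.PosDef)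
    (v : EuclideanSpace ℝ (Fin n)) :
    ‖v‖ ^ 2 ≤ inner ℝ v (Matrix.toEuclideanCLM (𝕜 := ℝ) A v) * l2Norm A⁻¹ := by
  obtain ⟨Q, R, hQ, hs, -, -⟩ := exists_selfAdjoint_sqrt hA
  set w := Matrix.toEuclideanCLM (𝕜 := ℝ) A⁻¹ v with hw
  have hAw : Matrix.toEuclideanCLM (𝕜 := ℝ) A w = v := by
    have := congrArg (fun T => Matrix.toEuclideanCLM (𝕜 := ℝ) T v)
      (Matrix.mul_nonsing_inv A (isUnit_iff_ne_zero.mpr hA.det_pos.ne'))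
    simpa [map_mul] using this
  have h1 : ‖v‖ ^ 2 = inner ℝ (Q v) (Q w) := by
    rw [hs, hQ, hAw, real_inner_self_eq_norm_sq]
  have h2 : ‖Q v‖ ^ 2 = inner ℝ v (Matrix.toEuclideanCLM (𝕜 := ℝ) A v) := by
    rw [← real_inner_self_eq_norm_sq, hs, hQ]
  have h3 : ‖Q w‖ ^ 2 ≤ l2Norm A⁻¹ * ‖v‖ ^ 2 := by
    rw [← real_inner_self_eq_norm_sq, hs, hQ, hAw]
    calc inner ℝ w v ≤ ‖w‖ * ‖v‖ := real_inner_le_norm _ _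
      _ ≤ (l2Norm A⁻¹ * ‖v‖) * ‖v‖ := by
        gcongr; exact ContinuousLinearMap.le_opNorm _ _
      _ = _ := by ring
  have h4 : ‖v‖ ^ 2 * ‖v‖ ^ 2 ≤ ‖Q v‖ ^ 2 * l2Norm A⁻¹ * ‖v‖ ^ 2 := by
    have h5 : ‖v‖ ^ 2 ≤ ‖Q v‖ * ‖Q w‖ := h1.le.trans (real_inner_le_norm _ _)
    calc ‖v‖ ^ 2 * ‖v‖ ^ 2 ≤ (‖Q v‖ * ‖Q w‖) * (‖Q v‖ * ‖Q w‖) := by gcongr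
      _ = ‖Q v‖ ^ 2 * ‖Q w‖ ^ 2 := by ring
      _ ≤ ‖Q v‖ ^ 2 * (l2Norm A⁻¹ * ‖v‖ ^ 2) := by gcongr
      _ = _ := by ring
  rw [← h2]
  rcases (norm_nonneg v).eq_or_lt with h | h
  · rw [← h, zero_pow two_ne_zero]
    have : 0 ≤ l2Norm A⁻¹ := norm_nonneg _
    positivity
  · exact le_of_mul_le_mul_right h4 (by positivity)

theorem toEuclideanCLM_hessian (f : EuclideanSpace ℝ (Fin n) → ℝ)
    (x : EuclideanSpace ℝ (Fin n)) :
    Matrix.toEuclideanCLM (𝕜 := ℝ) (hessian f x) = fderiv ℝ (gradient f) x := by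
  apply ContinuousLinearMap.coe_injective
  refine (EuclideanSpace.basisFun (Fin n) ℝ).toBasis.ext fun j => ?_
  ext i
  simp [hessian, Matrix.ofLp_toEuclideanCLM, Matrix.mulVec_single]

/-- Mean value inequality for `t ↦ ⟪∇f(xs + t v), v⟫` on `[0, 1]`, which starts at `0` and has
derivative at least `μ ‖v‖²`. Only existence of the Hessian is needed, not its continuity. -/
theorem ConvexityAssumption.exists_strong_monotone {f : EuclideanSpace ℝ (Fin n) → ℝ}
    {xs : EuclideanSpace ℝ (Fin n)} (h : ConvexityAssumption f xs) :
    ∃ μ : ℝ, 0 < μ ∧ ∀ v, μ * ‖v‖ ^ 2 ≤ inner ℝ (gradient f (xs + v)) v := by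
  obtain ⟨K, hK⟩ := h.bounded_inv
  have hK' : ∀ x, l2Norm (hessian f x)⁻¹ ≤ K := fun x => hK ⟨x, rfl⟩
  have hK0 : 0 ≤ K := (norm_nonneg _).trans (hK' xs)
  refine ⟨1 / (K + 1), by positivity, fun v => ?_⟩
  have hd : ∀ t : ℝ, HasDerivAt (fun t : ℝ => inner ℝ (gradient f (xs + t • v)) v)
      (inner ℝ (fderiv ℝ (gradient f) (xs + t • v) v) v) t := by
    intro t
    have h1 : HasDerivAt (fun t : ℝ => xs + t • v) v t := by
      simpa using ((hasDerivAt_id t).smul_const v).const_add xs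
    have h2 := (h.differentiable_gradient (xs + t • v)).hasFDerivAt.comp_hasDerivAt t h1
    simpa using h2.inner ℝ (hasDerivAt_const t v)
  have hle : ∀ t : ℝ, 1 / (K + 1) * ‖v‖ ^ 2
      ≤ deriv (fun t : ℝ => inner ℝ (gradient f (xs + t • v)) v) t := by
    intro t
    rw [(hd t).deriv]
    have h1 := norm_sq_le_inner_mul_l2Norm_inv (h.posDef (xs + t • v)) v
    rw [toEuclideanCLM_hessian, real_inner_comm] at h1
    have h2 := hK' (xs + t • v)
    have h3 : 0 ≤ l2Norm (hessian f (xs + t • v))⁻¹ := norm_nonneg _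
    set y := inner ℝ (fderiv ℝ (gradient f) (xs + t • v) v) v
    rw [one_div, inv_mul_le_iff₀ (by positivity)]
    have h4 : 0 ≤ y := by
      by_contra hneg
      push Not at hneg
      rcases h3.eq_or_lt with h5 | h5
      · have hv : v = 0 := by
          rw [← h5, mul_zero] at h1
          exact norm_eq_zero.mp (pow_eq_zero_iff two_ne_zero |>.mp (le_antisymm h1 (by positivity)))
        simp [y, hv] at hneg
      · nlinarith [sq_nonneg ‖v‖]
    nlinarith
  have := mul_sub_le_image_sub_of_le_deriv (fun t => (hd t).differentiableAt) hle
    (zero_le_one (α := ℝ))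
  simpa [(h.critical_iff xs).mpr rfl] using this

theorem ConvexityAssumption.exists_norm_gradient_le {f : EuclideanSpace ℝ (Fin n) → ℝ}
    {xs : EuclideanSpace ℝ (Fin n)} (h : ConvexityAssumption f xs) :
    ∃ l : ℝ, 0 ≤ l ∧ ∀ v, ‖gradient f (xs + v)‖ ≤ l * ‖v‖ := by
  obtain ⟨K, hK⟩ := h.bounded
  have hK' : ∀ x, ‖fderiv ℝ (gradient f) x‖ ≤ K := fun x => by
    rw [← toEuclideanCLM_hessian]; exact hK ⟨x, rfl⟩
  refine ⟨K, (norm_nonneg _).trans (hK' xs), fun v => ?_⟩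
  have := Convex.norm_image_sub_le_of_norm_fderiv_le (𝕜 := ℝ) (s := univ)
    (fun x _ => h.differentiable_gradient x) (fun x _ => hK' x) convex_univ
    (mem_univ xs) (mem_univ (xs + v))
  simpa [(h.critical_iff xs).mpr rfl] using this

theorem contDiffAt_gradient {f : EuclideanSpace ℝ (Fin n) → ℝ} {x : EuclideanSpace ℝ (Fin n)}
    (h : ContDiffAt ℝ 3 f x) : ContDiffAt ℝ 2 (gradient f) x := by
  have h1 : ContDiffAt ℝ 2 (fderiv ℝ f) x := h.fderiv_right (by norm_num)
  have h2 := (InnerProductSpace.toDual ℝ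
    (EuclideanSpace ℝ (Fin n))).symm.toContinuousLinearEquiv.contDiff (n := 2)
  exact h2.contDiffAt.comp x h1

/-- Near `x` the derivative is Lipschitz, giving the quadratic bound. At distance at least `r` the
global linear bound already is one, because `‖v‖ ≤ ‖v‖² / r`. -/
theorem exists_quadratic_remainder {E : Type*} [NormedAddCommGroup E] [NormedSpace ℝ E]
    {g : E → E} {x : E} (hd : Differentiable ℝ g) (hg : ContDiffAt ℝ 2 g x) {l : ℝ}
    (hl : ∀ v, ‖g (x + v)‖ ≤ l * ‖v‖) :
    ∃ C : ℝ, 0 ≤ C ∧ ∀ v, ‖g (x + v) - fderiv ℝ g x v‖ ≤ C * ‖v‖ ∧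
      ‖g (x + v) - fderiv ℝ g x v‖ ≤ C * ‖v‖ ^ 2 := by
  have hg0 : g x = 0 := by simpa using hl 0
  obtain ⟨K, t, ht, hK⟩ := (hg.fderiv_right (m := 1) (by norm_num)).exists_lipschitzOnWith
  obtain ⟨r, hr, hrt⟩ := Metric.mem_nhds_iff.mp ht
  set C₁ := |l| + ‖fderiv ℝ g x‖ with hC₁
  have h1 : ∀ v, ‖g (x + v) - fderiv ℝ g x v‖ ≤ C₁ * ‖v‖ := fun v => by
    calc _ ≤ ‖g (x + v)‖ + ‖fderiv ℝ g x v‖ := norm_sub_le _ _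
      _ ≤ |l| * ‖v‖ + ‖fderiv ℝ g x‖ * ‖v‖ := by
        gcongr
        · exact (hl v).trans (by gcongr; exact le_abs_self l)
        · exact ContinuousLinearMap.le_opNorm _ _
      _ = _ := by ring
  refine ⟨C₁ + K + C₁ / r, by positivity, fun v => ⟨(h1 v).trans ?_, ?_⟩⟩
  · gcongr
    have : 0 ≤ (K : ℝ) + C₁ / r := by positivity
    linarith
  · rcases lt_or_ge ‖v‖ r with hv | hv
    · have hsub : Metric.closedBall x ‖v‖ ⊆ t := fun y hy =>
        hrt (Metric.mem_ball.mpr ((Metric.mem_closedBall.mp hy).trans_lt hv))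
      have := (convex_closedBall x ‖v‖).norm_image_sub_le_of_norm_fderiv_le' (𝕜 := ℝ)
        (f := g) (φ := fderiv ℝ g x) (C := K * ‖v‖) (x := x) (y := x + v) (fun y _ => hd y) ?_
        (by simp) (by simp)
      · rw [hg0, sub_zero, add_sub_cancel_left] at this
        refine this.trans ?_
        have : 0 ≤ C₁ + C₁ / r := by positivity
        nlinarith [sq_nonneg ‖v‖]
      · intro y hy
        have h2 := hK.dist_le_mul y (hsub hy) x (hsub (by simp))
        rw [dist_eq_norm] at h2
        exact h2.trans (by gcongr; exact Metric.mem_closedBall.mp hy)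
    · refine (h1 v).trans ?_
      have h2 : C₁ * ‖v‖ ≤ C₁ / r * ‖v‖ ^ 2 := by
        rw [div_mul_eq_mul_div, le_div_iff₀ hr]
        have : 0 ≤ C₁ * ‖v‖ := by positivity
        nlinarith
      have : 0 ≤ C₁ + K := by positivity
      nlinarith [sq_nonneg ‖v‖]

end Analysis

/-! ### Rates for the iterates with a merely square-integrable start -/

section ProcessMoments

/-- For each `k` split at `‖z 1‖ ≤ k^{β/2}`. On this event `‖z 1‖` has a `p`-th moment of controlled
growth, and the `p`-th moment bound is used. On the complement, whose probability is `O(k^{-β})` by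
Chebyshev, the second moment bound suffices. -/
theorem exists_truncated_moment_bound {Ω : Type*} {mΩ : MeasurableSpace Ω} {P : Measure Ω}
    [IsProbabilityMeasure P] {E : Type*} [NormedAddCommGroup E] {ℱ : Filtration ℕ mΩ}
    {z : ℕ → Ω → E} {w : ℕ → Ω → ℝ} {β C K₂ K : ℝ} {p : ℕ} (hp2 : 2 ≤ p) (hp4 : p ≤ 4)
    (hβ : 0 ≤ β) (hC : 0 ≤ C) (hK₂ : 0 ≤ K₂) (hK : 0 ≤ K)
    (hz : StronglyMeasurable[ℱ 0] (z 1)) (hz2 : MemLp (z 1) 2 P)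
    (h2 : ∀ S : Set Ω, MeasurableSet[ℱ 0] S →
      IntegrableOn (fun ω => ‖z 1 ω‖ ^ 2) S P → ∀ k ≥ 1,
      IntegrableOn (fun ω => ‖z k ω‖ ^ 2) S P ∧
      ∫ ω in S, ‖z k ω‖ ^ 2 ∂P ≤ K₂ * (P.real S * (k : ℝ) ^ (-β)
        + (∫ ω in S, ‖z 1 ω‖ ^ 2 ∂P) * (k : ℝ) ^ (-(β * p))))
    (h : ∀ S : Set Ω, MeasurableSet[ℱ 0] S →
      IntegrableOn (fun ω => ‖z 1 ω‖ ^ p) S P → ∀ k ≥ 1,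
      IntegrableOn (fun ω => ‖z k ω‖ ^ p) S P ∧
      ∫ ω in S, ‖z k ω‖ ^ p ∂P ≤ K * (P.real S * (k : ℝ) ^ (-(β * p / 2))
        + (∫ ω in S, ‖z 1 ω‖ ^ p ∂P) * (k : ℝ) ^ (-(β * p))))
    (hw : ∀ k ≥ 1, Integrable (w k) P)
    (hw2 : ∀ k ≥ 1, ∀ ω, w k ω ≤ C * ‖z k ω‖ ^ 2) (hwp : ∀ k ≥ 1, ∀ ω, w k ω ≤ C * ‖z k ω‖ ^ p) :
    ∃ K' : ℝ, 0 ≤ K' ∧ ∀ k ≥ 1, ∫ ω, w k ω ∂P ≤ K' * (k : ℝ) ^ (-(β * p / 2)) := by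
  have hi2 : Integrable (fun ω => ‖z 1 ω‖ ^ 2) P := hz2.integrable_norm_pow two_ne_zero
  set V := ∫ ω, ‖z 1 ω‖ ^ 2 ∂P with hV
  have hV0 : 0 ≤ V := integral_nonneg fun ω => by positivity
  have hp' : (2 : ℝ) ≤ p := by exact_mod_cast hp2
  have hp4' : (p : ℝ) ≤ 4 := by exact_mod_cast hp4
  refine ⟨C * (K * (1 + V)) + C * (K₂ * (V + V)), by positivity, fun k hk => ?_⟩
  have hk1 : (1 : ℝ) ≤ k := by exact_mod_cast hk
  have hkpos : (0 : ℝ) < k := by linarith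
  set ρ : ℝ := (k : ℝ) ^ (β / 2) with hρ
  have hρ0 : 0 < ρ := by positivity
  set t : ℝ := (k : ℝ) ^ (-(β * p / 2)) with ht
  have ht0 : 0 ≤ t := by positivity
  set S : Set Ω := {ω | ‖z 1 ω‖ ≤ ρ} with hSdef
  have hS : MeasurableSet[ℱ 0] S := hz.norm.measurable measurableSet_Iic
  have hSm : MeasurableSet S := ℱ.le 0 S hS
  have hsplit : ∀ ω ∈ S, ‖z 1 ω‖ ^ p ≤ ρ ^ (p - 2) * ‖z 1 ω‖ ^ 2 := by
    intro ω hω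
    rw [← Nat.sub_add_cancel hp2, pow_add, Nat.sub_add_cancel hp2]
    gcongr
    exact hω
  have hzm : AEStronglyMeasurable (z 1) P := (hz.mono (ℱ.le 0)).aestronglyMeasurable
  have hiS : IntegrableOn (fun ω => ‖z 1 ω‖ ^ p) S P := by
    refine (hi2.integrableOn.const_mul (ρ ^ (p - 2))).mono' (hzm.norm.pow _).restrict ?_
    filter_upwards [ae_restrict_mem hSm] with ω hω
    rw [Real.norm_of_nonneg (by positivity)]
    exact hsplit ω hω
  have hVS : ∫ ω in S, ‖z 1 ω‖ ^ p ∂P ≤ ρ ^ (p - 2) * V := by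
    calc _ ≤ ∫ ω in S, ρ ^ (p - 2) * ‖z 1 ω‖ ^ 2 ∂P :=
          setIntegral_mono_on hiS (hi2.integrableOn.const_mul _) hSm hsplit
      _ = ρ ^ (p - 2) * ∫ ω in S, ‖z 1 ω‖ ^ 2 ∂P := integral_const_mul _ _
      _ ≤ _ := by
        gcongr
        exact setIntegral_le_integral hi2 (ae_of_all _ fun ω => by positivity)
  have hVSc : ∫ ω in Sᶜ, ‖z 1 ω‖ ^ 2 ∂P ≤ V :=
    setIntegral_le_integral hi2 (ae_of_all _ fun ω => by positivity)
  have hPSc : P.real Sᶜ ≤ V * (k : ℝ) ^ (-β) := by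
    have h1 : ρ ^ 2 * P.real Sᶜ ≤ V := by
      refine le_trans ?_ hVSc
      rw [mul_comm, ← smul_eq_mul, ← setIntegral_const]
      refine setIntegral_mono_on (integrable_const _).integrableOn hi2.integrableOn hSm.compl ?_
      intro ω hω
      have : ρ < ‖z 1 ω‖ := not_le.mp hω
      gcongr
    have h2 : ρ ^ 2 * (k : ℝ) ^ (-β) = 1 := by
      rw [hρ, ← Real.rpow_natCast, ← Real.rpow_mul hkpos.le, ← Real.rpow_add hkpos]
      norm_num
    calc P.real Sᶜ = (ρ ^ 2 * P.real Sᶜ) * (k : ℝ) ^ (-β) := by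
          rw [mul_right_comm, h2, one_mul]
      _ ≤ _ := by gcongr
  -- The truncated initial moment grows like `k^{β(p-2)/2}`; the forgetting exponent `β p`, twice
  -- the target, more than pays for it.
  have e1 : ρ ^ (p - 2) * (k : ℝ) ^ (-(β * p)) ≤ t := by
    rw [hρ, ← Real.rpow_natCast, ← Real.rpow_mul hkpos.le, ← Real.rpow_add hkpos]
    apply Real.rpow_le_rpow_of_exponent_le hk1
    rw [Nat.cast_sub hp2]
    push_cast
    nlinarith
  -- Small probability times second moment rate is `k^{-2β}`, enough because `p ≤ 4`.
  have e2 : (k : ℝ) ^ (-β) * (k : ℝ) ^ (-β) ≤ t := by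
    rw [← Real.rpow_add hkpos]
    apply Real.rpow_le_rpow_of_exponent_le hk1
    nlinarith
  have e3 : (k : ℝ) ^ (-(β * p)) ≤ t := by
    apply Real.rpow_le_rpow_of_exponent_le hk1
    nlinarith
  obtain ⟨hiSk, hbS⟩ := h S hS hiS k hk
  obtain ⟨hiSck, hbSc⟩ := h2 Sᶜ hS.compl hi2.integrableOn k hk
  rw [← integral_add_compl hSm (hw k hk)]
  have b1 : ∫ ω in S, w k ω ∂P ≤ C * (K * (1 + V)) * t := by
    calc _ ≤ ∫ ω in S, C * ‖z k ω‖ ^ p ∂P :=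
          integral_mono_ae (hw k hk).integrableOn (hiSk.const_mul C) (ae_of_all _ (hwp k hk))
      _ = C * ∫ ω in S, ‖z k ω‖ ^ p ∂P := integral_const_mul _ _
      _ ≤ C * (K * (P.real S * t + (∫ ω in S, ‖z 1 ω‖ ^ p ∂P) * (k : ℝ) ^ (-(β * p)))) := by
        gcongr
      _ ≤ C * (K * (1 * t + (ρ ^ (p - 2) * V) * (k : ℝ) ^ (-(β * p)))) := by
        gcongr; exact measureReal_le_one
      _ = C * (K * (1 * t + (ρ ^ (p - 2) * (k : ℝ) ^ (-(β * p))) * V)) := by ring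
      _ ≤ C * (K * (1 * t + t * V)) := by gcongr
      _ = _ := by ring
  have b2 : ∫ ω in Sᶜ, w k ω ∂P ≤ C * (K₂ * (V + V)) * t := by
    calc _ ≤ ∫ ω in Sᶜ, C * ‖z k ω‖ ^ 2 ∂P :=
          integral_mono_ae (hw k hk).integrableOn (hiSck.const_mul C) (ae_of_all _ (hw2 k hk))
      _ = C * ∫ ω in Sᶜ, ‖z k ω‖ ^ 2 ∂P := integral_const_mul _ _
      _ ≤ C * (K₂ * (P.real Sᶜ * (k : ℝ) ^ (-β)
          + (∫ ω in Sᶜ, ‖z 1 ω‖ ^ 2 ∂P) * (k : ℝ) ^ (-(β * p)))) := by gcongr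
      _ ≤ C * (K₂ * ((V * (k : ℝ) ^ (-β)) * (k : ℝ) ^ (-β) + V * t)) := by gcongr
      _ = C * (K₂ * (V * ((k : ℝ) ^ (-β) * (k : ℝ) ^ (-β)) + V * t)) := by ring
      _ ≤ C * (K₂ * (V * t + V * t)) := by gcongr
      _ = _ := by ring
  linarith

/-- The equivalence gives constants beyond some `k₀`; positivity handles the finitely many earlier
indices, adjusting the constants one index at a time. -/
theorem SampleSizeAssumption.exists_bounds {N : ℕ → ℝ} {q : ℝ} (h : SampleSizeAssumption N q) :
    ∃ a b : ℝ, 0 < a ∧ 0 < b ∧ ∀ k : ℕ, k ≥ 1 → a * (k : ℝ) ^ q ≤ N k ∧ N k ≤ b * (k : ℝ) ^ q := by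
  obtain ⟨ν, hν, heq⟩ := h.equivalent
  have hlim : Tendsto (fun k : ℕ => N k / (ν * (k : ℝ) ^ q)) atTop (𝓝 1) := by
    refine (Asymptotics.isEquivalent_iff_tendsto_one ?_).mp heq
    filter_upwards [eventually_ge_atTop 1] with k hk
    have : (0 : ℝ) < k := by exact_mod_cast hk
    positivity
  obtain ⟨k₀, hk₀⟩ := eventually_atTop.mp
    ((hlim.eventually (lt_mem_nhds (show (1 / 2 : ℝ) < 1 by norm_num))).and
      (hlim.eventually (gt_mem_nhds (show (1 : ℝ) < 2 by norm_num))))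
  have key : ∀ K : ℕ, ∃ a b : ℝ, 0 < a ∧ 0 < b ∧ ∀ k : ℕ, k ≥ 1 → k < K →
      a * (k : ℝ) ^ q ≤ N k ∧ N k ≤ b * (k : ℝ) ^ q := by
    intro K
    induction K with
    | zero => exact ⟨1, 1, one_pos, one_pos, fun k _ hk => absurd hk (Nat.not_lt_zero k)⟩
    | succ K ih =>
      obtain ⟨a, b, ha, hb, hab⟩ := ih
      rcases Nat.eq_zero_or_pos K with rfl | hK
      · exact ⟨1, 1, one_pos, one_pos, fun k hk hk' => by omega⟩
      · have hK' : (0 : ℝ) < K := by exact_mod_cast hK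
        have hNK := h.pos K hK
        have hKq : (0 : ℝ) < (K : ℝ) ^ q := by positivity
        refine ⟨min a (N K / (K : ℝ) ^ q), max b (N K / (K : ℝ) ^ q), by positivity,
          by positivity, fun k hk hkK => ?_⟩
        have hkq : (0 : ℝ) ≤ (k : ℝ) ^ q := by positivity
        rcases (Nat.lt_succ_iff.mp hkK).lt_or_eq with hlt | rfl
        · obtain ⟨h1, h2⟩ := hab k hk hlt
          exact ⟨(mul_le_mul_of_nonneg_right (min_le_left _ _) hkq).trans h1,
            h2.trans (mul_le_mul_of_nonneg_right (le_max_left _ _) hkq)⟩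
        · have e : N k = N k / (k : ℝ) ^ q * (k : ℝ) ^ q := by field_simp
          constructor
          · conv_rhs => rw [e]
            exact mul_le_mul_of_nonneg_right (min_le_right _ _) hkq
          · conv_lhs => rw [e]
            exact mul_le_mul_of_nonneg_right (le_max_right _ _) hkq
  obtain ⟨a, b, ha, hb, hab⟩ := key k₀
  refine ⟨min a (ν / 2), max b (2 * ν), by positivity, by positivity, fun k hk => ?_⟩
  have hk' : (0 : ℝ) < k := by exact_mod_cast hk
  have hkq : (0 : ℝ) < (k : ℝ) ^ q := by positivity
  rcases lt_or_ge k k₀ with hlt | hge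
  · obtain ⟨h1, h2⟩ := hab k hk hlt
    exact ⟨(mul_le_mul_of_nonneg_right (min_le_left _ _) hkq.le).trans h1,
      h2.trans (mul_le_mul_of_nonneg_right (le_max_left _ _) hkq.le)⟩
  · obtain ⟨h1, h2⟩ := hk₀ k hge
    rw [lt_div_iff₀ (by positivity)] at h1
    rw [div_lt_iff₀ (by positivity)] at h2
    refine ⟨(mul_le_mul_of_nonneg_right (min_le_right _ _) hkq.le).trans (by linarith),
      le_trans (by linarith) (mul_le_mul_of_nonneg_right (le_max_right _ _) hkq.le)⟩

theorem MomentAssumption.exists_bound {n : ℕ} {Ω : Type*} {mΩ : MeasurableSpace Ω} {P : Measure Ω}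
    [IsProbabilityMeasure P] {ℱ : Filtration ℕ mΩ} {N : ℕ → ℝ}
    {ε : ℕ → Ω → EuclideanSpace ℝ (Fin n)} {M : ℕ} {q : ℝ} (h : MomentAssumption P ℱ N ε M)
    (hN : SampleSizeAssumption N q)
    (hε : ∀ k ≥ 1, StronglyMeasurable[ℱ k] (ε k))
    (Q : EuclideanSpace ℝ (Fin n) →L[ℝ] EuclideanSpace ℝ (Fin n)) {j : ℕ} (hj : 2 ≤ j)
    (hjM : j ≤ M) :
    ∃ C : ℝ, 0 ≤ C ∧ ∀ k ≥ 1, Integrable (fun ω => ‖Q (ε k ω)‖ ^ j) P ∧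
      ∀ᵐ ω ∂P, (P[fun ω' => ‖Q (ε k ω')‖ ^ j | ℱ (k - 1)]) ω
        ≤ C * ((k : ℝ) ^ (-(q / 2))) ^ j := by
  obtain ⟨C, hC⟩ := h j hj hjM
  obtain ⟨a, b, ha, hb, hab⟩ := hN.exists_bounds
  refine ⟨‖Q‖ ^ j * (|C| * a ^ (-((j : ℝ) / 2))), by positivity, fun k hk => ?_⟩
  obtain ⟨hi, hle⟩ := hC k hk
  have hk' : (0 : ℝ) < k := by exact_mod_cast hk
  have hpt : ∀ ω, ‖Q (ε k ω)‖ ^ j ≤ ‖Q‖ ^ j * ‖ε k ω‖ ^ j := fun ω => by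
    rw [← mul_pow]; gcongr; exact Q.le_opNorm _
  have hiQ : Integrable (fun ω => ‖Q (ε k ω)‖ ^ j) P := by
    refine (hi.const_mul (‖Q‖ ^ j)).mono' ?_ (ae_of_all _ fun ω => ?_)
    · exact ((Q.continuous.comp_stronglyMeasurable
        ((hε k hk).mono (ℱ.le k))).norm.pow _).aestronglyMeasurable
    · rw [Real.norm_of_nonneg (by positivity)]; exact hpt ω
  refine ⟨hiQ, ?_⟩
  have h1 := condExp_mono (m := ℱ (k - 1)) hiQ (hi.const_mul (‖Q‖ ^ j)) (ae_of_all _ hpt)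
  have h2 := condExp_smul (μ := P) (‖Q‖ ^ j) (fun ω => ‖ε k ω‖ ^ j) (ℱ (k - 1))
  filter_upwards [h1, h2, hle] with ω hω1 hω2 hω3
  refine hω1.trans ?_
  change (P[(‖Q‖ ^ j) • (fun ω => ‖ε k ω‖ ^ j) | ℱ (k - 1)]) ω ≤ _
  rw [hω2, Pi.smul_apply, smul_eq_mul, mul_assoc]
  gcongr
  have hNk := hN.pos k hk
  have h3 : (P[fun ω' => ‖ε k ω'‖ ^ j | ℱ (k - 1)]) ω ≤ |C| * N k ^ (-((j : ℝ) / 2)) := by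
    rw [Real.rpow_neg hNk.le, ← div_eq_mul_inv, le_div_iff₀ (by positivity), mul_comm]
    exact hω3.trans (le_abs_self C)
  refine h3.trans ?_
  rw [mul_assoc]
  gcongr
  have e : ((k : ℝ) ^ (-(q / 2))) ^ j = ((k : ℝ) ^ q) ^ (-((j : ℝ) / 2)) := by
    rw [← Real.rpow_natCast, ← Real.rpow_mul hk'.le, ← Real.rpow_mul hk'.le]; congr 1; ring
  rw [e, ← Real.mul_rpow ha.le (by positivity)]
  exact Real.rpow_le_rpow_of_nonpos (by positivity) (hab k hk).1
    (neg_nonpos.mpr (by positivity))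

/-- `D ∘ ∇f` need not be monotone for the Euclidean inner product, but with `Q = D^{1/2}` and `z =
Q⁻¹(x - xs)` the drift becomes `v ↦ Q ∇f(xs + Q v)`, which is strongly monotone since `Q` is
self-adjoint and invertible. -/
theorem IsProcess.exists_moment_bounds {n : ℕ} {Ω : Type*} {mΩ : MeasurableSpace Ω}
    {P : Measure Ω} [IsProbabilityMeasure P] {ℱ : Filtration ℕ mΩ}
    {f : EuclideanSpace ℝ (Fin n) → ℝ} {xs : EuclideanSpace ℝ (Fin n)}
    {A : ℕ → Matrix (Fin n) (Fin n) ℝ} {D : Matrix (Fin n) (Fin n) ℝ}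
    {ε x : ℕ → Ω → EuclideanSpace ℝ (Fin n)} {N : ℕ → ℝ} {c α q : ℝ} {M p : ℕ}
    (hproc : IsProcess P ℱ f A ε x) (hconv : ConvexityAssumption f xs)
    (hmom : MomentAssumption P ℱ N ε M) (hc : 0 ≤ c) (hD : D.PosDef)
    (hA : ∀ k : ℕ, 1 ≤ k → A k = ((k : ℝ) + c) ^ (-α) • D) (hq : 0 ≤ q)
    (hN : SampleSizeAssumption N q) (hα0 : 0 < α) (hα1 : α < 1) (hp : p = 3 ∨ p = 4)
    (hpM : p ≤ M) {ρ : EuclideanSpace ℝ (Fin n) → EuclideanSpace ℝ (Fin n)} (hρ : Continuous ρ)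
    {C : ℝ} (hC : 0 ≤ C) (hρ1 : ∀ v, ‖ρ v‖ ≤ C * ‖v‖) (hρ2 : ∀ v, ‖ρ v‖ ≤ C * ‖v‖ ^ 2) :
    ∃ K : ℝ, 0 ≤ K ∧ ∀ k ≥ 1, StronglyMeasurable[ℱ (k - 1)] (x k) ∧
      MemLp (fun ω => x k ω - xs) 2 P ∧ MemLp (fun ω => ρ (x k ω - xs)) 2 P ∧
      ∫ ω, ‖x k ω - xs‖ ^ 2 ∂P ≤ K * (k : ℝ) ^ (-(α + q)) ∧
      ∫ ω, ‖ρ (x k ω - xs)‖ ^ 2 ∂P ≤ K * (k : ℝ) ^ (-((α + q) * p / 2)) := by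
  obtain ⟨Q, R, hQQ, hQs, hQR, hRQ⟩ := exists_selfAdjoint_sqrt hD
  obtain ⟨μ, hμ, hmono⟩ := hconv.exists_strong_monotone
  obtain ⟨l, hl, hlip⟩ := hconv.exists_norm_gradient_le
  set F : EuclideanSpace ℝ (Fin n) → EuclideanSpace ℝ (Fin n) :=
    fun v => Q (gradient f (xs + Q v)) with hFdef
  set z : ℕ → Ω → EuclideanSpace ℝ (Fin n) := fun k ω => R (x k ω - xs) with hzdef
  have hQz : ∀ k ω, Q (z k ω) = x k ω - xs := fun k ω => hQR _
  have hgc : Continuous (gradient f) := hconv.differentiable_gradient.continuous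
  have hF : Continuous F := Q.continuous.comp (hgc.comp (continuous_const.add Q.continuous))
  have hFμ : ∀ v, μ / (‖R‖ ^ 2 + 1) * ‖v‖ ^ 2 ≤ inner ℝ (F v) v := fun v => by
    rw [hFdef, hQs]
    refine le_trans ?_ (hmono (Q v))
    have h1 : ‖v‖ ^ 2 ≤ (‖R‖ ^ 2 + 1) * ‖Q v‖ ^ 2 := by
      calc ‖v‖ ^ 2 = ‖R (Q v)‖ ^ 2 := by rw [hRQ]
        _ ≤ (‖R‖ * ‖Q v‖) ^ 2 := by gcongr; exact R.le_opNorm _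
        _ ≤ _ := by nlinarith [sq_nonneg ‖Q v‖]
    rw [div_mul_eq_mul_div, div_le_iff₀ (by positivity)]
    nlinarith
  have hFl : ∀ v, ‖F v‖ ≤ (‖Q‖ * l * ‖Q‖) * ‖v‖ := fun v => by
    calc ‖F v‖ ≤ ‖Q‖ * ‖gradient f (xs + Q v)‖ := Q.le_opNorm _
      _ ≤ ‖Q‖ * (l * (‖Q‖ * ‖v‖)) := by
        gcongr
        exact (hlip _).trans (by gcongr; exact Q.le_opNorm _)
      _ = _ := by ring
  have hz1 : StronglyMeasurable[ℱ 0] (z 1) :=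
    R.continuous.comp_stronglyMeasurable (hproc.initial_measurable.sub stronglyMeasurable_const)
  have hz12 : MemLp (z 1) 2 P := R.comp_memLp' (hproc.initial_memLp.sub (memLp_const xs))
  have hup : ∀ k ≥ 1, ∀ ω, z (k + 1) ω
      = z k ω - ((k : ℝ) + c) ^ (-α) • (F (z k ω) + Q (ε k ω)) := by
    intro k hk ω
    have h1 : ∀ v, R (Matrix.toEuclideanCLM (𝕜 := ℝ) D v) = Q v := fun v => by
      rw [← hQQ, hRQ]
    simp only [hzdef, hFdef]
    rw [hproc.update k hk ω, hA k hk, map_smul, smul_apply, sub_right_comm,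
      map_sub R, map_smul R, h1, map_add, hQR, add_sub_cancel]
  have hξm : ∀ k ≥ 1, StronglyMeasurable[ℱ k] (fun ω => Q (ε k ω)) := fun k hk =>
    Q.continuous.comp_stronglyMeasurable (hproc.noise_measurable k hk)
  have hξ : ∀ k ≥ 1, Integrable (fun ω => Q (ε k ω)) P := fun k hk =>
    Q.integrable_comp (hproc.noise_integrable k hk)
  have hξ0 : ∀ k ≥ 1, P[fun ω => Q (ε k ω) | ℱ (k - 1)] =ᵐ[P] 0 := by
    intro k hk
    have h1 := Q.comp_condExp_comm (m := ℱ (k - 1)) (hproc.noise_integrable k hk)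
    filter_upwards [h1, hproc.noise_mean_zero k hk] with ω hω h0ω
    have : (P[Q ∘ ε k | ℱ (k - 1)]) ω = 0 := by
      rw [← hω, Function.comp_apply, h0ω]; simp
    exact this
  have hmomQ := fun j hj hjM => hmom.exists_bound hN hproc.noise_measurable Q (j := j) hj hjM
  have hp2 : 2 ≤ p := by omega
  have hR2 : (α + q) * ((2 : ℕ) : ℝ) / 2 ≤ (α + q) * p := by
    have : (2 : ℝ) ≤ p := by exact_mod_cast hp2
    push_cast
    nlinarith
  have hRp : (α + q) * (p : ℝ) / 2 ≤ (α + q) * p := by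
    have : 0 ≤ (α + q) * (p : ℝ) := by positivity
    linarith
  obtain ⟨K₂, hK₂, hb₂⟩ := exists_moment_bound (p := 2) (Or.inl rfl) hα0 hα1 hc hq hR2 hF
    (by positivity) hFμ (by positivity) hFl hz1 hup hξm hξ hξ0 (fun j hj => hmomQ j (by omega)
      (by omega))
  obtain ⟨Kp, hKp, hbp⟩ := exists_moment_bound (p := p) (Or.inr hp) hα0 hα1 hc hq hRp hF
    (by positivity) hFμ (by positivity) hFl hz1 hup hξm hξ hξ0 (fun j hj => hmomQ j (by omega)
      (by omega))
  have hxm : ∀ k ≥ 1, StronglyMeasurable[ℱ (k - 1)] (x k) := by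
    intro k hk
    induction k, hk using Nat.le_induction with
    | base => exact hproc.initial_measurable
    | succ k hk ih =>
      have h1 : StronglyMeasurable[ℱ k] (x k) := ih.mono (ℱ.mono (Nat.sub_le k 1))
      rw [show x (k + 1) = fun ω => x k ω - Matrix.toEuclideanCLM (𝕜 := ℝ) (A k)
        (gradient f (x k ω) + ε k ω) from funext (hproc.update k hk)]
      exact h1.sub ((Matrix.toEuclideanCLM (𝕜 := ℝ) (A k)).continuous.comp_stronglyMeasurable
        ((hgc.comp_stronglyMeasurable h1).add (hproc.noise_measurable k hk)))
  have hem : ∀ k ≥ 1, AEStronglyMeasurable (fun ω => x k ω - xs) P := fun k hk =>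
    (((hxm k hk).mono (ℱ.le _)).sub stronglyMeasurable_const).aestronglyMeasurable
  have hzx : ∀ k ω, ‖x k ω - xs‖ ≤ ‖Q‖ * ‖z k ω‖ := fun k ω => by
    rw [← hQz]; exact Q.le_opNorm _
  have hi2 : IntegrableOn (fun ω => ‖z 1 ω‖ ^ 2) univ P :=
    (hz12.integrable_norm_pow two_ne_zero).integrableOn
  have hzk := hb₂ univ MeasurableSet.univ hi2
  simp only [Measure.restrict_univ, integrableOn_univ] at hzk
  have heint : ∀ k ≥ 1, MemLp (fun ω => x k ω - xs) 2 P := by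
    intro k hk
    rw [memLp_two_iff_integrable_sq_norm (hem k hk)]
    refine ((hzk k hk).1.const_mul (‖Q‖ ^ 2)).mono' ((hem k hk).norm.pow 2)
      (ae_of_all _ fun ω => ?_)
    rw [Real.norm_of_nonneg (by positivity), ← mul_pow]
    have := hzx k ω
    gcongr
  have hrint : ∀ k ≥ 1, MemLp (fun ω => ρ (x k ω - xs)) 2 P := fun k hk =>
    (heint k hk).of_le_mul (hρ.comp_aestronglyMeasurable (hem k hk))
      (ae_of_all _ fun ω => hρ1 _)
  have hρ2' : ∀ v, ‖ρ v‖ ^ 2 ≤ C ^ 2 * ‖v‖ ^ 2 := fun v => by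
    rw [← mul_pow]; have := hρ1 v; gcongr
  -- For `p = 3` multiply the linear bound by the quadratic one; for `p = 4` square the quadratic
  -- one.
  have hρp' : ∀ v, ‖ρ v‖ ^ 2 ≤ C ^ 2 * ‖v‖ ^ p := fun v => by
    have h1 := hρ1 v
    have h2 := hρ2 v
    rcases hp with rfl | rfl
    · calc ‖ρ v‖ ^ 2 = ‖ρ v‖ * ‖ρ v‖ := sq _
        _ ≤ (C * ‖v‖) * (C * ‖v‖ ^ 2) := by gcongr
        _ = _ := by ring
    · calc ‖ρ v‖ ^ 2 ≤ (C * ‖v‖ ^ 2) ^ 2 := by gcongr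
        _ = _ := by ring
  set B := C ^ 2 * (‖Q‖ ^ 2 + ‖Q‖ ^ p) with hB
  obtain ⟨K, hK, hKb⟩ := exists_truncated_moment_bound (ℱ := ℱ) (z := z) (P := P)
    (w := fun k ω => ‖ρ (x k ω - xs)‖ ^ 2) (β := α + q) (C := B) (K₂ := K₂) (K := Kp) (p := p)
    hp2 (by omega) (by positivity) (by positivity) hK₂ hKp hz1 hz12
    (fun S hS hi k hk => by
      have := hb₂ S hS hi k hk
      rwa [show (α + q) * ((2 : ℕ) : ℝ) / 2 = α + q by push_cast; ring] at this) hbp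
    (fun k hk => (hrint k hk).integrable_norm_pow two_ne_zero)
    (fun k hk ω => by
      refine (hρ2' _).trans ?_
      calc _ ≤ C ^ 2 * (‖Q‖ * ‖z k ω‖) ^ 2 := by have := hzx k ω; gcongr
        _ = C ^ 2 * ‖Q‖ ^ 2 * ‖z k ω‖ ^ 2 := by ring
        _ ≤ B * ‖z k ω‖ ^ 2 := by
          rw [hB]; gcongr; exact le_add_of_nonneg_right (by positivity))
    (fun k hk ω => by
      refine (hρp' _).trans ?_
      calc _ ≤ C ^ 2 * (‖Q‖ * ‖z k ω‖) ^ p := by have := hzx k ω; gcongr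
        _ = C ^ 2 * ‖Q‖ ^ p * ‖z k ω‖ ^ p := by ring
        _ ≤ B * ‖z k ω‖ ^ p := by
          rw [hB]; gcongr; exact le_add_of_nonneg_left (by positivity))
  set V := ∫ ω, ‖z 1 ω‖ ^ 2 ∂P with hV
  have hV0 : 0 ≤ V := integral_nonneg fun ω => by positivity
  set G := ‖Q‖ ^ 2 * (K₂ * (1 + V)) with hG
  have hG0 : 0 ≤ G := by positivity
  refine ⟨G + K, by positivity, fun k hk => ⟨hxm k hk, heint k hk, hrint k hk, ?_, ?_⟩⟩
  · have hk1 : (1 : ℝ) ≤ k := by exact_mod_cast hk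
    have h1 := (hzk k hk).2
    rw [show (α + q) * ((2 : ℕ) : ℝ) / 2 = α + q by push_cast; ring, probReal_univ, one_mul] at h1
    have h2 : (k : ℝ) ^ (-((α + q) * p)) ≤ (k : ℝ) ^ (-(α + q)) := by
      apply Real.rpow_le_rpow_of_exponent_le hk1
      have : (2 : ℝ) ≤ p := by exact_mod_cast hp2
      nlinarith
    have h3 : 0 ≤ (k : ℝ) ^ (-(α + q)) := by positivity
    calc ∫ ω, ‖x k ω - xs‖ ^ 2 ∂P ≤ ∫ ω, ‖Q‖ ^ 2 * ‖z k ω‖ ^ 2 ∂P := by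
          refine integral_mono ((heint k hk).integrable_norm_pow two_ne_zero)
            ((hzk k hk).1.const_mul _) fun ω => ?_
          have := hzx k ω
          dsimp only
          rw [← mul_pow]; gcongr
      _ = ‖Q‖ ^ 2 * ∫ ω, ‖z k ω‖ ^ 2 ∂P := integral_const_mul _ _
      _ ≤ ‖Q‖ ^ 2 * (K₂ * ((k : ℝ) ^ (-(α + q)) + V * (k : ℝ) ^ (-((α + q) * p)))) := by gcongr
      _ ≤ ‖Q‖ ^ 2 * (K₂ * ((k : ℝ) ^ (-(α + q)) + V * (k : ℝ) ^ (-(α + q)))) := by gcongr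
      _ = G * (k : ℝ) ^ (-(α + q)) := by rw [hG]; ring
      _ ≤ _ := by gcongr; linarith
  · refine (hKb k hk).trans ?_
    gcongr
    linarith

end ProcessMoments

/-! ### Asymptotic covariance of the noise and of its weighted sums -/

section NoiseCovariance

/-- The iterates converge to `xs` in `L²`, so `x_k` lies in a small ball with probability close to
`1`. There the rescaled conditional covariance is uniformly close to `Sig2`; elsewhere the
conditional moment bound controls it by `C` times a small probability. -/
theorem tendsto_noise_covariance {n : ℕ} {Ω : Type*} {mΩ : MeasurableSpace Ω} {P : Measure Ω}
    [IsProbabilityMeasure P] {ℱ : Filtration ℕ mΩ} {N : ℕ → ℝ}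
    {ε x : ℕ → Ω → EuclideanSpace ℝ (Fin n)} {xs : EuclideanSpace ℝ (Fin n)}
    {Sig2 : Matrix (Fin n) (Fin n) ℝ} (hcov : CovarianceAssumption P N ε x xs Sig2)
    (hN : ∀ k ≥ 1, 0 < N k) (hε : ∀ k ≥ 1, AEStronglyMeasurable (ε k) P) {C : ℝ} (hC : 0 ≤ C)
    (hmom : ∀ k ≥ 1, Integrable (fun ω => ‖ε k ω‖ ^ 2) P ∧
      ∀ᵐ ω ∂P, N k * (P[fun ω' => ‖ε k ω'‖ ^ 2 | ℱ (k - 1)]) ω ≤ C)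
    (hxm : ∀ k ≥ 1, StronglyMeasurable[ℱ (k - 1)] (x k))
    (hxi : ∀ k ≥ 1, Integrable (fun ω => ‖x k ω - xs‖ ^ 2) P)
    (hx : Tendsto (fun k => ∫ ω, ‖x k ω - xs‖ ^ 2 ∂P) atTop (𝓝 0)) (i j : Fin n) :
    Tendsto (fun k => N k * ∫ ω, ε k ω i * ε k ω j ∂P) atTop (𝓝 (Sig2 i j)) := by
  obtain ⟨-, U, hU, Ut, V, hV, hunif, hcont, hUt⟩ := hcov
  rw [Metric.tendsto_atTop]
  intro η hη
  -- Collects the three errors: `2 δ` inside the ball (uniform convergence and continuity), `C δ`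
  -- outside it, and `|Sig2 i j| δ` from the missing mass.
  set H : ℝ := 2 + C + |Sig2 i j| with hH
  have hH0 : 0 < H := by positivity
  set δ : ℝ := η / (2 * H) with hδ
  have hδ0 : 0 < δ := by positivity
  have hcontij : ContinuousAt (fun y => Ut y i j) xs := by
    have h1 : ContinuousAt Ut xs := hcont.continuousAt hV
    have h2 : Continuous fun T : Matrix (Fin n) (Fin n) ℝ => T i j :=
      (continuous_apply j).comp (continuous_apply i)
    exact h2.continuousAt.comp h1
  have hnear : ∀ᶠ y in 𝓝 xs, y ∈ V ∧ |Ut y i j - Sig2 i j| < δ := by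
    refine Filter.Eventually.and hV ?_
    have := Metric.tendsto_nhds.mp hcontij δ hδ0
    simpa [Real.dist_eq, hUt] using this
  obtain ⟨r, hr, hball⟩ := Metric.eventually_nhds_iff_ball.mp hnear
  have hun := Metric.tendstoUniformlyOn_iff.mp (hunif i j) δ hδ0
  have hsmall := hx.eventually (gt_mem_nhds (show 0 < δ * r ^ 2 by positivity))
  obtain ⟨k₀, hk₀⟩ := eventually_atTop.mp (hun.and (hsmall.and (eventually_ge_atTop 1)))
  refine ⟨k₀, fun k hk => ?_⟩
  obtain ⟨hunk, hsm, hk1⟩ := hk₀ k hk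
  obtain ⟨hi2, hmk⟩ := hmom k hk1
  have hNk := hN k hk1
  have hxmeas : Measurable (x k) := ((hxm k hk1).mono (ℱ.le _)).measurable
  have hprod : ∀ ω, ‖ε k ω i * ε k ω j‖ ≤ ‖ε k ω‖ ^ 2 := fun ω => by
    rw [norm_mul, sq]
    exact mul_le_mul (PiLp.norm_apply_le _ _) (PiLp.norm_apply_le _ _) (norm_nonneg _)
      (norm_nonneg _)
  have hcoord : ∀ a : Fin n, AEStronglyMeasurable (fun ω => ε k ω a) P := fun a =>
    (EuclideanSpace.proj (𝕜 := ℝ) a).continuous.comp_aestronglyMeasurable (hε k hk1)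
  have hint : Integrable (fun ω => ε k ω i * ε k ω j) P :=
    hi2.mono' ((hcoord i).mul (hcoord j)) (ae_of_all _ hprod)
  set 𝒢 : MeasurableSpace Ω := MeasurableSpace.comap (x k) inferInstance with h𝒢
  have h𝒢le : 𝒢 ≤ mΩ := hxmeas.comap_le
  set G : Set Ω := x k ⁻¹' Metric.ball xs r with hG
  have hG𝒢 : MeasurableSet[𝒢] G := ⟨_, measurableSet_ball, rfl⟩
  have hGm : MeasurableSet[mΩ] G := h𝒢le _ hG𝒢
  have hGF : MeasurableSet[ℱ (k - 1)] G := (hxm k hk1).measurable measurableSet_ball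
  obtain ⟨-, hUk⟩ := hU k hk1 i j
  have hUi : Integrable (fun ω => U k (x k ω) i j) P := integrable_condExp.congr hUk.symm
  have hGint : ∫ ω in G, ε k ω i * ε k ω j ∂P = ∫ ω in G, U k (x k ω) i j ∂P := by
    rw [← setIntegral_condExp h𝒢le hint hG𝒢]
    exact setIntegral_congr_ae hGm (hUk.mono fun ω hω _ => hω.symm)
  have hPG : P.real Gᶜ ≤ δ := by
    have h1 : r ^ 2 * P.real Gᶜ ≤ δ * r ^ 2 := by
      refine le_trans ?_ hsm.le
      refine le_trans ?_ (setIntegral_le_integral (hxi k hk1) (s := Gᶜ)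
        (ae_of_all _ fun ω => by positivity))
      rw [mul_comm, ← smul_eq_mul, ← setIntegral_const]
      refine setIntegral_mono_on (integrable_const _).integrableOn (hxi k hk1).integrableOn
        hGm.compl fun ω hω => ?_
      have : r ≤ ‖x k ω - xs‖ := by
        rw [← dist_eq_norm]; exact not_lt.mp fun h => hω (Metric.mem_ball.mpr h)
      gcongr
    rw [mul_comm δ] at h1
    exact le_of_mul_le_mul_left h1 (by positivity)
  have hPGc0 : 0 ≤ P.real Gᶜ := measureReal_nonneg
  have hPG1 : P.real G ≤ 1 := measureReal_le_one
  have hPGe : P.real G = 1 - P.real Gᶜ := by rw [probReal_compl_eq_one_sub hGm]; ring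
  have b1 : |N k * ∫ ω in G, ε k ω i * ε k ω j ∂P - Sig2 i j * P.real G| ≤ 2 * δ := by
    have e : N k * ∫ ω in G, ε k ω i * ε k ω j ∂P - Sig2 i j * P.real G
        = ∫ ω in G, (N k * U k (x k ω) i j - Sig2 i j) ∂P := by
      rw [hGint, integral_sub (hUi.integrableOn.const_mul _) (integrable_const _).integrableOn,
        integral_const_mul, setIntegral_const, smul_eq_mul, mul_comm (P.real G)]
    rw [e, ← Real.norm_eq_abs]
    refine (norm_setIntegral_le_of_norm_le_const (C := 2 * δ) (measure_lt_top _ _)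
      fun ω hω => ?_).trans ?_
    · obtain ⟨hv, hd⟩ := hball (x k ω) hω
      have h1 := hunk (x k ω) hv
      rw [Real.dist_eq, abs_sub_comm] at h1
      rw [Real.norm_eq_abs]
      calc |N k * U k (x k ω) i j - Sig2 i j|
          ≤ |N k * U k (x k ω) i j - Ut (x k ω) i j| + |Ut (x k ω) i j - Sig2 i j| :=
            abs_sub_le _ _ _
        _ ≤ _ := by linarith
    · nlinarith
  have b2 : |N k * ∫ ω in Gᶜ, ε k ω i * ε k ω j ∂P| ≤ C * δ := by
    rw [abs_mul, abs_of_pos hNk]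
    have h1 : |∫ ω in Gᶜ, ε k ω i * ε k ω j ∂P| ≤ ∫ ω in Gᶜ, ‖ε k ω‖ ^ 2 ∂P :=
      norm_integral_le_of_norm_le hi2.integrableOn (ae_of_all _ hprod)
    calc _ ≤ N k * ∫ ω in Gᶜ, ‖ε k ω‖ ^ 2 ∂P := by gcongr
      _ = ∫ ω in Gᶜ, N k * (P[fun ω' => ‖ε k ω'‖ ^ 2 | ℱ (k - 1)]) ω ∂P := by
        rw [integral_const_mul, setIntegral_condExp (ℱ.le _) hi2 hGF.compl]
      _ ≤ ∫ ω in Gᶜ, C ∂P :=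
        setIntegral_mono_ae (integrable_condExp.const_mul _).integrableOn
          (integrable_const _).integrableOn hmk
      _ = C * P.real Gᶜ := by rw [setIntegral_const, smul_eq_mul, mul_comm]
      _ ≤ _ := by gcongr
  have b3 : |Sig2 i j * P.real G - Sig2 i j| ≤ |Sig2 i j| * δ := by
    rw [show Sig2 i j * P.real G - Sig2 i j = -(Sig2 i j * P.real Gᶜ) by rw [hPGe]; ring, abs_neg,
      abs_mul, abs_of_nonneg hPGc0]
    gcongr
  rw [Real.dist_eq, ← integral_add_compl hGm hint, mul_add]
  have hfin : H * δ < η := by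
    rw [hδ, mul_div_assoc', div_lt_iff₀ (by positivity)]; nlinarith
  rw [abs_le] at b1 b2 b3
  rw [abs_lt]
  constructor <;> nlinarith

/-- Martingale differences are orthogonal: each new noise term is centred given the past, so the
cross terms integrate to zero. -/
theorem integral_weighted_noise_sum_mul {n : ℕ} {Ω : Type*} {mΩ : MeasurableSpace Ω}
    {P : Measure Ω} [IsProbabilityMeasure P] {ℱ : Filtration ℕ mΩ} {N : ℕ → ℝ}
    {ε : ℕ → Ω → EuclideanSpace ℝ (Fin n)} (hε : ∀ k ≥ 1, StronglyMeasurable[ℱ k] (ε k))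
    (hε2 : ∀ k ≥ 1, MemLp (ε k) 2 P) (hε0 : ∀ k ≥ 1, P[ε k | ℱ (k - 1)] =ᵐ[P] 0)
    (a b : Fin n) (k : ℕ) :
    ∫ ω, (∑ i ∈ Finset.Icc 1 k, N i • ε (i + 1) ω) a
        * (∑ i ∈ Finset.Icc 1 k, N i • ε (i + 1) ω) b ∂P
      = ∑ i ∈ Finset.Icc 1 k, N i ^ 2 * ∫ ω, ε (i + 1) ω a * ε (i + 1) ω b ∂P := by
  have hL : ∀ k, MemLp (fun ω => ∑ i ∈ Finset.Icc 1 k, N i • ε (i + 1) ω) 2 P := fun k =>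
    memLp_finsetSum _ fun i _ => (hε2 (i + 1) (by omega)).const_smul (N i)
  have hm : ∀ k, StronglyMeasurable[ℱ (k + 1)]
      (fun ω => ∑ i ∈ Finset.Icc 1 k, N i • ε (i + 1) ω) := fun k =>
    Finset.stronglyMeasurable_fun_sum _ fun i hi =>
      ((hε (i + 1) (by omega)).mono
        (ℱ.mono (by have := (Finset.mem_Icc.mp hi).2; omega))).const_smul (N i)
  have hproj : ∀ {X : Ω → EuclideanSpace ℝ (Fin n)} (c : Fin n), MemLp X 2 P →
      MemLp (fun ω => X ω c) 2 P := fun c hX =>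
    (EuclideanSpace.proj (𝕜 := ℝ) c).comp_memLp' hX
  have hcross : ∀ (c d : Fin n) (k : ℕ), ∫ ω, (∑ i ∈ Finset.Icc 1 k, N i • ε (i + 1) ω) c
      * ε (k + 2) ω d ∂P = 0 := by
    intro c d k
    have e : ∀ ω, (∑ i ∈ Finset.Icc 1 k, N i • ε (i + 1) ω) c * ε (k + 2) ω d
        = inner ℝ ((∑ i ∈ Finset.Icc 1 k, N i • ε (i + 1) ω) c • EuclideanSpace.single d (1 : ℝ))
          (ε (k + 2) ω) := fun ω => by
      rw [real_inner_smul_left, EuclideanSpace.inner_single_left]; simp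
    have hi : Integrable (fun ω => (∑ i ∈ Finset.Icc 1 k, N i • ε (i + 1) ω) c
        * ε (k + 2) ω d) P :=
      (hproj c (hL k)).integrable_mul (hproj d (hε2 (k + 2) (by omega)))
    simp only [e] at hi ⊢
    refine integral_inner_eq_zero (ℱ.le (k + 1)) ?_
      ((hε2 (k + 2) (by omega)).integrable one_le_two) hi (hε0 (k + 2) (by omega))
    exact ((EuclideanSpace.proj (𝕜 := ℝ) c).continuous.comp_stronglyMeasurable (hm k)).smul
      stronglyMeasurable_const
  induction k with
  | zero => simp
  | succ k ih =>
    simp only [Finset.sum_Icc_succ_top (Nat.le_add_left 1 k)]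
    rw [← ih]
    set Y : Ω → EuclideanSpace ℝ (Fin n) := fun ω => ∑ i ∈ Finset.Icc 1 k, N i • ε (i + 1) ω
      with hY
    have i1 : Integrable (fun ω => Y ω a * Y ω b) P :=
      (hproj a (hL k)).integrable_mul (hproj b (hL k))
    have i2 : Integrable (fun ω => Y ω a * ε (k + 2) ω b) P :=
      (hproj a (hL k)).integrable_mul (hproj b (hε2 (k + 2) (by omega)))
    have i3 : Integrable (fun ω => Y ω b * ε (k + 2) ω a) P :=
      (hproj b (hL k)).integrable_mul (hproj a (hε2 (k + 2) (by omega)))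
    have i4 : Integrable (fun ω => ε (k + 2) ω a * ε (k + 2) ω b) P :=
      (hproj a (hε2 (k + 2) (by omega))).integrable_mul (hproj b (hε2 (k + 2) (by omega)))
    have e : ∀ ω, (∑ i ∈ Finset.Icc 1 k, N i • ε (i + 1) ω + N (k + 1) • ε (k + 1 + 1) ω) a
        * (∑ i ∈ Finset.Icc 1 k, N i • ε (i + 1) ω + N (k + 1) • ε (k + 1 + 1) ω) b
        = (Y ω a * Y ω b + N (k + 1) * (Y ω a * ε (k + 2) ω b))
          + (N (k + 1) * (Y ω b * ε (k + 2) ω a)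
            + N (k + 1) ^ 2 * (ε (k + 2) ω a * ε (k + 2) ω b)) := fun ω => by
      simp only [PiLp.add_apply, PiLp.smul_apply, smul_eq_mul, hY]; ring
    simp only [e]
    have i12 : Integrable (fun ω => Y ω a * Y ω b + N (k + 1) * (Y ω a * ε (k + 2) ω b)) P :=
      i1.add (i2.const_mul _)
    have i34 : Integrable (fun ω => N (k + 1) * (Y ω b * ε (k + 2) ω a)
        + N (k + 1) ^ 2 * (ε (k + 2) ω a * ε (k + 2) ω b)) P :=
      (i3.const_mul _).add (i4.const_mul _)
    rw [integral_add i12 i34,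
      integral_add i1 (i2.const_mul _), integral_add (i3.const_mul _) (i4.const_mul _),
      integral_const_mul, integral_const_mul, integral_const_mul, hcross a b k, hcross b a k]
    ring

end NoiseCovariance

/-! ### Weighted Cesàro means and Abel summation -/

section Averages

theorem sum_Icc_one_eq_sum_range {E : Type*} [AddCommMonoid E] (F : ℕ → E) (k : ℕ) :
    ∑ i ∈ Finset.Icc 1 k, F i = ∑ i ∈ Finset.range k, F (i + 1) := by
  induction k with
  | zero => simp
  | succ k ih => rw [Finset.sum_Icc_succ_top (Nat.le_add_left 1 k), ih, Finset.sum_range_succ]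

theorem tendsto_weighted_average {w u : ℕ → ℝ} {l : ℝ} (hw : ∀ k ≥ 1, 0 < w k)
    (hW : Tendsto (fun k => ∑ i ∈ Finset.Icc 1 k, w i) atTop atTop)
    (hu : Tendsto u atTop (𝓝 l)) :
    Tendsto (fun k => (∑ i ∈ Finset.Icc 1 k, w i * u i) / ∑ i ∈ Finset.Icc 1 k, w i) atTop
      (𝓝 l) := by
  have h1 : (fun i => w (i + 1) * (u (i + 1) - l)) =o[atTop] fun i => w (i + 1) := by
    have h2 : (fun i => u (i + 1) - l) =o[atTop] fun _ => (1 : ℝ) := by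
      rw [Asymptotics.isLittleO_one_iff]
      simpa using ((tendsto_add_atTop_iff_nat 1).mpr hu).sub_const l
    simpa using (Asymptotics.isBigO_refl (fun i => w (i + 1)) atTop).mul_isLittleO h2
  simp only [sum_Icc_one_eq_sum_range] at hW ⊢
  have h3 := (h1.sum_range (fun i => (hw (i + 1) (by omega)).le) hW).tendsto_div_nhds_zero
  have h4 := h3.add_const l
  rw [zero_add] at h4
  refine h4.congr' ?_
  filter_upwards [hW.eventually_gt_atTop 0] with k hk
  simp only [mul_sub, Finset.sum_sub_distrib, ← Finset.sum_mul]
  field_simp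
  ring

/-- Since `w_k ≤ 2 √W_k (√W_k - √W_{k-1})`, the summand is negligible against the increments of
`√W`, which telescope to the denominator. -/
theorem tendsto_sum_div_sqrt_sum {w u : ℕ → ℝ} (hw : ∀ k ≥ 1, 0 < w k)
    (hW : Tendsto (fun k => ∑ i ∈ Finset.Icc 1 k, w i) atTop atTop)
    (hu : Tendsto (fun k => √(∑ i ∈ Finset.Icc 1 k, w i) * u k) atTop (𝓝 0)) :
    Tendsto (fun k => (∑ i ∈ Finset.Icc 1 k, w i * u i) / √(∑ i ∈ Finset.Icc 1 k, w i)) atTop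
      (𝓝 0) := by
  set W : ℕ → ℝ := fun k => ∑ i ∈ Finset.Icc 1 k, w i with hWdef
  set d : ℕ → ℝ := fun k => √(W (k + 1)) - √(W k) with hd
  have hW0 : ∀ k, 0 ≤ W k := fun k =>
    Finset.sum_nonneg fun i hi => (hw i (Finset.mem_Icc.mp hi).1).le
  have hWs : ∀ k, W (k + 1) = W k + w (k + 1) := fun k =>
    Finset.sum_Icc_succ_top (Nat.le_add_left 1 k) _
  have hdsum : ∀ k, ∑ i ∈ Finset.range k, d i = √(W k) := fun k => by
    rw [Finset.sum_range_sub (fun k => √(W k))]; simp [hWdef]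
  have hsq := Real.tendsto_sqrt_atTop.comp hW
  have hd0 : ∀ k, 0 ≤ d k := fun k =>
    sub_nonneg.mpr (Real.sqrt_le_sqrt (by rw [hWs]; linarith [hw (k + 1) (by omega)]))
  have hwd : ∀ k, w (k + 1) ≤ 2 * √(W (k + 1)) * d k := fun k => by
    have h1 := Real.sq_sqrt (hW0 (k + 1))
    have h2 := Real.sq_sqrt (hW0 k)
    have h3 := hd0 k
    have h4 : w (k + 1) = √(W (k + 1)) ^ 2 - √(W k) ^ 2 := by rw [h1, h2, hWs]; ring
    rw [h4]
    simp only [hd] at h3 ⊢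
    nlinarith
  have h1 : (fun i => w (i + 1) * u (i + 1)) =o[atTop] d := by
    have h2 : (fun i => √(W (i + 1)) * u (i + 1)) =o[atTop] fun _ => (1 : ℝ) := by
      rw [Asymptotics.isLittleO_one_iff]
      exact (tendsto_add_atTop_iff_nat 1).mpr hu
    have h3 : (fun i => w (i + 1) * u (i + 1))
        =O[atTop] fun i => d i * (√(W (i + 1)) * u (i + 1)) := by
      refine Asymptotics.IsBigO.of_bound 2 (Eventually.of_forall fun i => ?_)
      rw [norm_mul, norm_mul, norm_mul, Real.norm_of_nonneg (hw (i + 1) (by omega)).le,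
        Real.norm_of_nonneg (hd0 i), Real.norm_of_nonneg (Real.sqrt_nonneg _)]
      calc _ ≤ 2 * √(W (i + 1)) * d i * ‖u (i + 1)‖ := by gcongr; exact hwd i
        _ = _ := by ring
    simpa using h3.trans_isLittleO ((Asymptotics.isBigO_refl d atTop).mul_isLittleO h2)
  have h5 := (h1.sum_range hd0 (by simp only [hdsum]; exact hsq)).tendsto_div_nhds_zero
  simpa only [hdsum, ← sum_Icc_one_eq_sum_range (fun i => w i * u i)] using h5

/-- Summation by parts leaves terms `(b_{k+1} - b_k) e_{k+2}`, bounded through `b_{k+1} - b_k ≤ 2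
√b_{k+1} (√b_{k+1} - √b_k)` by `2 K` times an increment of `√b`. The normed space is left general so
that it can be `L²`. -/
theorem norm_sum_smul_sub_le {E : Type*} [NormedAddCommGroup E] [NormedSpace ℝ E] {e : ℕ → E}
    {b : ℕ → ℝ} {K : ℝ} (hK : 0 ≤ K) (hb : ∀ k ≥ 1, 0 < b k) (hmono : ∀ k ≥ 1, b k ≤ b (k + 1))
    (he : ∀ k ≥ 1, √(b k) * ‖e (k + 1)‖ ≤ K) {k : ℕ} (hk : 1 ≤ k) :
    ‖∑ i ∈ Finset.Icc 1 k, b i • (e (i + 1) - e (i + 2))‖ ≤ 3 * K * √(b k) := by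
  -- Adding the boundary term `b k • e (k + 2)` gives the summed-by-parts form, whose increments
  -- have a sign-definite coefficient; it is removed at the end at the cost of one more `K * √(b
  -- k)`.
  have key : ∀ k ≥ 1, ‖∑ i ∈ Finset.Icc 1 k, b i • (e (i + 1) - e (i + 2)) + b k • e (k + 2)‖
      ≤ 2 * K * √(b k) := by
    intro k hk
    induction k, hk using Nat.le_induction with
    | base =>
      have h1 := he 1 le_rfl
      have h2 := (hb 1 le_rfl).le
      have h3 := Real.sq_sqrt h2
      simp only [Finset.Icc_self, Finset.sum_singleton, smul_sub, sub_add_cancel]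
      rw [norm_smul, Real.norm_of_nonneg h2]
      have h4 := Real.sqrt_nonneg (b 1)
      calc b 1 * ‖e (1 + 1)‖ = √(b 1) * (√(b 1) * ‖e (1 + 1)‖) := by
            rw [← mul_assoc, Real.mul_self_sqrt h2]
        _ ≤ √(b 1) * K := by gcongr
        _ ≤ 2 * K * √(b 1) := by nlinarith [mul_nonneg hK h4]
    | succ k hk ih =>
      have e1 : ∑ i ∈ Finset.Icc 1 (k + 1), b i • (e (i + 1) - e (i + 2))
          + b (k + 1) • e (k + 1 + 2)
          = (∑ i ∈ Finset.Icc 1 k, b i • (e (i + 1) - e (i + 2)) + b k • e (k + 2))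
            + (b (k + 1) - b k) • e (k + 2) := by
        rw [Finset.sum_Icc_succ_top (Nat.le_add_left 1 k), smul_sub, sub_smul,
          show k + 1 + 1 = k + 2 from rfl]
        abel
      rw [e1]
      have h1 := he (k + 1) (by omega)
      rw [show k + 1 + 1 = k + 2 from rfl] at h1
      have h2 := hmono k hk
      have h3 := Real.sq_sqrt (hb k hk).le
      have h4 := Real.sq_sqrt (hb (k + 1) (by omega)).le
      have h5 := Real.sqrt_le_sqrt h2
      have h6 := Real.sqrt_nonneg (b k)
      refine (norm_add_le _ _).trans ?_
      rw [norm_smul, Real.norm_of_nonneg (sub_nonneg.mpr h2)]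
      have h7 : (b (k + 1) - b k) * ‖e (k + 2)‖ ≤ 2 * K * (√(b (k + 1)) - √(b k)) := by
        set s := √(b (k + 1))
        set t := √(b k)
        calc (b (k + 1) - b k) * ‖e (k + 2)‖ = (s - t) * ((s + t) * ‖e (k + 2)‖) := by
              rw [← h3, ← h4]; ring
          _ ≤ (s - t) * ((s + s) * ‖e (k + 2)‖) := by
            have := sub_nonneg.mpr h5
            gcongr
          _ = 2 * (s - t) * (s * ‖e (k + 2)‖) := by ring
          _ ≤ 2 * (s - t) * K := by
            have := sub_nonneg.mpr h5
            gcongr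
          _ = _ := by ring
      linarith
  have h1 := key k hk
  have h2 : ‖b k • e (k + 2)‖ ≤ K * √(b k) := by
    rw [norm_smul, Real.norm_of_nonneg (hb k hk).le]
    calc b k * ‖e (k + 2)‖ = √(b k) * (√(b k) * ‖e (k + 2)‖) := by
          rw [← mul_assoc, Real.mul_self_sqrt (hb k hk).le]
      _ ≤ √(b k) * (√(b (k + 1)) * ‖e (k + 1 + 1)‖) := by
          gcongr; exact hmono k hk
      _ ≤ √(b k) * K := by gcongr; exact he (k + 1) (by omega)
      _ = _ := mul_comm _ _
  calc _ = ‖(∑ i ∈ Finset.Icc 1 k, b i • (e (i + 1) - e (i + 2)) + b k • e (k + 2))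
        - b k • e (k + 2)‖ := by rw [add_sub_cancel_right]
    _ ≤ _ := norm_sub_le _ _
    _ ≤ _ := by linarith

end Averages

/-! ### The `L²` norm and negligible perturbations of second moments -/

section SquareIntegrable

variable {Ω : Type*} {mΩ : MeasurableSpace Ω} {P : Measure Ω} {E : Type*} [NormedAddCommGroup E]
  [InnerProductSpace ℝ E]

theorem norm_toLp_eq_sqrt {F : Ω → E} (hF : MemLp F 2 P) :
    ‖hF.toLp F‖ = √(∫ ω, ‖F ω‖ ^ 2 ∂P) := by
  rw [← Real.sqrt_sq (norm_nonneg _), ← real_inner_self_eq_norm_sq, L2.inner_def]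
  congr 1
  refine integral_congr_ae ?_
  filter_upwards [hF.coeFn_toLp] with ω hω
  rw [hω, real_inner_self_eq_norm_sq]

theorem abs_integral_mul_le_sqrt_mul_sqrt {f g : Ω → ℝ} (hf : MemLp f 2 P) (hg : MemLp g 2 P) :
    |∫ ω, f ω * g ω ∂P| ≤ √(∫ ω, ‖f ω‖ ^ 2 ∂P) * √(∫ ω, ‖g ω‖ ^ 2 ∂P) := by
  rw [← norm_toLp_eq_sqrt hf, ← norm_toLp_eq_sqrt hg]
  refine le_trans (le_of_eq ?_) (abs_real_inner_le_norm (hf.toLp f) (hg.toLp g))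
  rw [L2.inner_def]
  congr 1
  refine integral_congr_ae ?_
  filter_upwards [hf.coeFn_toLp, hg.coeFn_toLp] with ω h1 h2
  rw [h1, h2]; simp [mul_comm]

theorem toLp_sum_smul (s : Finset ℕ) (c : ℕ → ℝ) {F : ℕ → Ω → E} (hF : ∀ i, MemLp (F i) 2 P) :
    ∃ h : MemLp (fun ω => ∑ i ∈ s, c i • F i ω) 2 P,
      h.toLp _ = ∑ i ∈ s, c i • (hF i).toLp (F i) := by
  induction s using Finset.induction_on with
  | empty => exact ⟨by simp, by simp; rfl⟩
  | insert a s ha ih =>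
    obtain ⟨h, hs⟩ := ih
    have h' := ((hF a).const_smul (c a)).add h
    have e : (fun ω => ∑ i ∈ insert a s, c i • F i ω)
        = (c a • F a) + fun ω => ∑ i ∈ s, c i • F i ω := by
      ext ω; simp [Finset.sum_insert ha]
    refine ⟨e ▸ h', ?_⟩
    rw [Finset.sum_insert ha, ← hs, ← MemLp.toLp_const_smul, ← MemLp.toLp_add]
    congr 1

theorem sqrt_integral_norm_sum_smul (s : Finset ℕ) (c : ℕ → ℝ) {F : ℕ → Ω → E}
    (hF : ∀ i, MemLp (F i) 2 P) :
    √(∫ ω, ‖∑ i ∈ s, c i • F i ω‖ ^ 2 ∂P) = ‖∑ i ∈ s, c i • (hF i).toLp (F i)‖ := by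
  obtain ⟨h, hs⟩ := toLp_sum_smul s c hF
  rw [← hs, norm_toLp_eq_sqrt]

theorem sqrt_integral_norm_sum_smul_le (s : Finset ℕ) {c : ℕ → ℝ} (hc : ∀ i ∈ s, 0 ≤ c i)
    {F : ℕ → Ω → E} (hF : ∀ i, MemLp (F i) 2 P) :
    √(∫ ω, ‖∑ i ∈ s, c i • F i ω‖ ^ 2 ∂P) ≤ ∑ i ∈ s, c i * √(∫ ω, ‖F i ω‖ ^ 2 ∂P) := by
  rw [sqrt_integral_norm_sum_smul s c hF]
  refine (norm_sum_le _ _).trans (Finset.sum_le_sum fun i hi => ?_)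
  rw [norm_smul, Real.norm_of_nonneg (hc i hi), norm_toLp_eq_sqrt]

theorem sqrt_integral_norm_sum_smul_sub_le {X : ℕ → Ω → E} (hX : ∀ k, MemLp (X k) 2 P)
    {b : ℕ → ℝ} {K : ℝ} (hK : 0 ≤ K) (hb : ∀ k ≥ 1, 0 < b k) (hmono : ∀ k ≥ 1, b k ≤ b (k + 1))
    (he : ∀ k ≥ 1, √(b k) * √(∫ ω, ‖X (k + 1) ω‖ ^ 2 ∂P) ≤ K) {k : ℕ} (hk : 1 ≤ k) :
    √(∫ ω, ‖∑ i ∈ Finset.Icc 1 k, b i • (X (i + 1) ω - X (i + 2) ω)‖ ^ 2 ∂P)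
      ≤ 3 * K * √(b k) := by
  have h1 := sqrt_integral_norm_sum_smul (Finset.Icc 1 k) b
    (F := fun i => X (i + 1) - X (i + 2)) fun i => (hX (i + 1)).sub (hX (i + 2))
  simp only [Pi.sub_apply] at h1
  rw [h1]
  exact norm_sum_smul_sub_le (e := fun i => (hX i).toLp (X i)) hK hb hmono
    (fun k hk => by rw [norm_toLp_eq_sqrt]; exact he k hk) hk

theorem tendsto_integral_mul_of_perturbation {n : ℕ} {Y Z R : ℕ → Ω → EuclideanSpace ℝ (Fin n)}
    {W : ℕ → ℝ} {Sig : Matrix (Fin n) (Fin n) ℝ} (hY : ∀ k, MemLp (Y k) 2 P)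
    (hR : ∀ k, MemLp (R k) 2 P) (hZ : ∀ k ω, Z k ω = R k ω - Y k ω) (hW : ∀ k, 0 ≤ W k)
    (hYlim : ∀ a b, Tendsto (fun k => (∫ ω, Y k ω a * Y k ω b ∂P) / W k) atTop (𝓝 (Sig a b)))
    (hRlim : Tendsto (fun k => √(∫ ω, ‖R k ω‖ ^ 2 ∂P) / √(W k)) atTop (𝓝 0)) (a b : Fin n) :
    Tendsto (fun k => (∫ ω, Z k ω a * Z k ω b ∂P) / W k) atTop (𝓝 (Sig a b)) := by
  have hproj : ∀ {X : Ω → EuclideanSpace ℝ (Fin n)} (c : Fin n), MemLp X 2 P →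
      MemLp (fun ω => X ω c) 2 P := fun c hX =>
    (EuclideanSpace.proj (𝕜 := ℝ) c).comp_memLp' hX
  have hcoord : ∀ {X : Ω → EuclideanSpace ℝ (Fin n)} (c : Fin n), MemLp X 2 P →
      √(∫ ω, ‖X ω c‖ ^ 2 ∂P) ≤ √(∫ ω, ‖X ω‖ ^ 2 ∂P) := fun c hX =>
    Real.sqrt_le_sqrt <| integral_mono ((hproj c hX).integrable_norm_pow two_ne_zero)
      (hX.integrable_norm_pow two_ne_zero) fun ω => by
        dsimp only
        gcongr; exact PiLp.norm_apply_le _ _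
  have hYn : ∀ c, Tendsto (fun k => √(∫ ω, ‖Y k ω c‖ ^ 2 ∂P) / √(W k)) atTop
      (𝓝 √(Sig c c)) := fun c => by
    refine (Real.continuous_sqrt.continuousAt.tendsto.comp (hYlim c c)).congr fun k => ?_
    rw [Function.comp_apply, Real.sqrt_div' _ (hW k)]
    congr 2
    refine integral_congr_ae (ae_of_all _ fun ω => ?_)
    simp [sq]
  have hRY : ∀ c d, Tendsto (fun k => (∫ ω, R k ω c * Y k ω d ∂P) / W k) atTop (𝓝 0) := by
    intro c d
    have h1 := hRlim.mul (hYn d)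
    rw [zero_mul] at h1
    refine squeeze_zero_norm (fun k => ?_) h1
    rw [norm_div, Real.norm_of_nonneg (hW k), Real.norm_eq_abs, div_mul_div_comm,
      Real.mul_self_sqrt (hW k)]
    have := hW k
    gcongr
    exact (abs_integral_mul_le_sqrt_mul_sqrt (hproj c (hR k)) (hproj d (hY k))).trans
      (mul_le_mul_of_nonneg_right (hcoord c (hR k)) (Real.sqrt_nonneg _))
  have hRR : Tendsto (fun k => (∫ ω, R k ω a * R k ω b ∂P) / W k) atTop (𝓝 0) := by
    have h1 := hRlim.mul hRlim
    rw [zero_mul] at h1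
    refine squeeze_zero_norm (fun k => ?_) h1
    rw [norm_div, Real.norm_of_nonneg (hW k), Real.norm_eq_abs, div_mul_div_comm,
      Real.mul_self_sqrt (hW k)]
    have := hW k
    gcongr
    exact (abs_integral_mul_le_sqrt_mul_sqrt (hproj a (hR k)) (hproj b (hR k))).trans
      (mul_le_mul (hcoord a (hR k)) (hcoord b (hR k)) (Real.sqrt_nonneg _) (Real.sqrt_nonneg _))
  have hall := ((hRR.sub (hRY a b)).sub (hRY b a)).add (hYlim a b)
  simp only [sub_zero, zero_add] at hall
  refine hall.congr fun k => ?_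
  rw [← sub_div, ← sub_div, ← add_div]
  congr 1
  have i1 := (hproj a (hR k)).integrable_mul (hproj b (hR k))
  have i2 := (hproj a (hR k)).integrable_mul (hproj b (hY k))
  have i3 := (hproj b (hR k)).integrable_mul (hproj a (hY k))
  have i4 := (hproj a (hY k)).integrable_mul (hproj b (hY k))
  rw [← integral_sub (by exact i1) (by exact i2), ← integral_sub (by exact i1.sub i2) (by exact i3),
    ← integral_add (by exact (i1.sub i2).sub i3) (by exact i4)]
  refine integral_congr_ae (ae_of_all _ fun ω => ?_)
  simp only [hZ, PiLp.sub_apply]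
  ring

end SquareIntegrable

/-! ### Growth of the sample sizes and of their sums -/

section SampleSizes

variable {N : ℕ → ℝ} {q : ℝ}

theorem SampleSizeAssumption.tendsto_ratio (h : SampleSizeAssumption N q) :
    Tendsto (fun k => N k / N (k + 1)) atTop (𝓝 1) := by
  obtain ⟨ν, hν, heq⟩ := h.equivalent
  have hlim : Tendsto (fun k : ℕ => N k / (ν * (k : ℝ) ^ q)) atTop (𝓝 1) := by
    refine (Asymptotics.isEquivalent_iff_tendsto_one ?_).mp heq
    filter_upwards [eventually_ge_atTop 1] with k hk
    have : (0 : ℝ) < k := by exact_mod_cast hk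
    positivity
  have h1 := (tendsto_add_atTop_iff_nat 1).mpr hlim
  have h2 : Tendsto (fun k : ℕ => ((k : ℝ) / ((k : ℝ) + 1)) ^ q) atTop (𝓝 1) := by
    have h3 : Tendsto (fun k : ℕ => (k : ℝ) / ((k : ℝ) + 1)) atTop (𝓝 1) :=
      tendsto_natCast_div_add_atTop 1
    simpa using h3.rpow_const (p := q) (Or.inl one_ne_zero)
  have h4 := (hlim.div h1 one_ne_zero).mul h2
  rw [div_one, one_mul] at h4
  refine h4.congr' ?_
  filter_upwards [eventually_ge_atTop 1] with k hk
  have hk' : (0 : ℝ) < k := by exact_mod_cast hk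
  have hN := h.pos (k + 1) (by omega)
  have hq1 : ((k : ℝ) + 1) ^ q ≠ 0 := by positivity
  have hq2 : (k : ℝ) ^ q ≠ 0 := by positivity
  rw [Pi.div_apply, Real.div_rpow hk'.le (by positivity)]
  push_cast
  field_simp

/-- Induction on `k`, where Bernoulli's inequality bounds the increment of `k ^ (q + 1)` by `(q + 1)
* (k + 1) ^ q`. -/
theorem rpow_add_one_le_sum_rpow (hq : 0 ≤ q) (k : ℕ) :
    (k : ℝ) ^ (q + 1) ≤ (q + 1) * ∑ i ∈ Finset.Icc 1 k, (i : ℝ) ^ q := by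
  induction k with
  | zero => simp [Real.zero_rpow (by linarith : q + 1 ≠ 0)]
  | succ k ih =>
    rw [Finset.sum_Icc_succ_top (Nat.le_add_left 1 k), mul_add]
    have hk : (0 : ℝ) < (k : ℝ) + 1 := by positivity
    have hB := one_add_mul_self_le_rpow_one_add (s := -1 / ((k : ℝ) + 1))
      (by rw [le_div_iff₀ hk]; linarith [k.cast_nonneg (α := ℝ)]) (p := q + 1) (by linarith)
    have e1 : 1 + -1 / ((k : ℝ) + 1) = k / ((k : ℝ) + 1) := by field_simp; ring
    rw [e1, Real.div_rpow k.cast_nonneg hk.le, le_div_iff₀ (by positivity)] at hB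
    push_cast
    have e2 : ((k : ℝ) + 1) ^ (q + 1) = ((k : ℝ) + 1) ^ q * ((k : ℝ) + 1) := by
      rw [Real.rpow_add hk, Real.rpow_one]
    have e3 : (1 + (q + 1) * (-1 / ((k : ℝ) + 1))) * ((k : ℝ) + 1) ^ (q + 1)
        = ((k : ℝ) + 1) ^ (q + 1) - (q + 1) * ((k : ℝ) + 1) ^ q := by
      rw [e2]; field_simp; ring
    rw [e3] at hB
    linarith

theorem SampleSizeAssumption.exists_sum_bounds (h : SampleSizeAssumption N q) (hq : 0 ≤ q) :
    ∃ a b : ℝ, 0 < a ∧ 0 < b ∧ ∀ k : ℕ, k ≥ 1 →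
      a * (k : ℝ) ^ (q + 1) ≤ ∑ i ∈ Finset.Icc 1 k, N i ∧
      ∑ i ∈ Finset.Icc 1 k, N i ≤ b * (k : ℝ) ^ (q + 1) := by
  obtain ⟨a, b, ha, hb, hab⟩ := h.exists_bounds
  refine ⟨a / (q + 1), b, by positivity, hb, fun k hk => ⟨?_, ?_⟩⟩
  · calc _ ≤ a / (q + 1) * ((q + 1) * ∑ i ∈ Finset.Icc 1 k, (i : ℝ) ^ q) := by
          gcongr; exact rpow_add_one_le_sum_rpow hq k
      _ = ∑ i ∈ Finset.Icc 1 k, a * (i : ℝ) ^ q := by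
          rw [← Finset.mul_sum]; field_simp
      _ ≤ _ := Finset.sum_le_sum fun i hi => (hab i (Finset.mem_Icc.mp hi).1).1
  · have hk' : (0 : ℝ) < k := by exact_mod_cast hk
    calc _ ≤ ∑ i ∈ Finset.Icc 1 k, b * (k : ℝ) ^ q := by
          refine Finset.sum_le_sum fun i hi => ?_
          obtain ⟨h1, h2⟩ := Finset.mem_Icc.mp hi
          refine (hab i h1).2.trans ?_
          gcongr
      _ = _ := by
          rw [Finset.sum_const, Nat.card_Icc, nsmul_eq_mul, Nat.add_sub_cancel,
            Real.rpow_add hk', Real.rpow_one]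
          ring

end SampleSizes

/-! ### Negligibility of the telescoping and nonlinear sums -/

section Remainder

variable {Ω : Type*} {mΩ : MeasurableSpace Ω} {P : Measure Ω} {E : Type*} [NormedAddCommGroup E]
  [InnerProductSpace ℝ E]

theorem sqrt_integral_norm_sub_le {F G : Ω → E} (hF : MemLp F 2 P) (hG : MemLp G 2 P) :
    √(∫ ω, ‖F ω - G ω‖ ^ 2 ∂P) ≤ √(∫ ω, ‖F ω‖ ^ 2 ∂P) + √(∫ ω, ‖G ω‖ ^ 2 ∂P) := by
  have h := norm_sub_le (hF.toLp F) (hG.toLp G)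
  rw [← MemLp.toLp_sub, norm_toLp_eq_sqrt, norm_toLp_eq_sqrt, norm_toLp_eq_sqrt] at h
  exact h

theorem sqrt_integral_norm_map_le (T : E →L[ℝ] E) {F : Ω → E} (hF : MemLp F 2 P) :
    √(∫ ω, ‖T (F ω)‖ ^ 2 ∂P) ≤ ‖T‖ * √(∫ ω, ‖F ω‖ ^ 2 ∂P) := by
  rw [← Real.sqrt_sq (norm_nonneg T), ← Real.sqrt_mul (sq_nonneg _), ← integral_const_mul]
  refine Real.sqrt_le_sqrt (integral_mono ((T.comp_memLp' hF).integrable_norm_pow two_ne_zero)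
    ((hF.integrable_norm_pow two_ne_zero).const_mul _) fun ω => ?_)
  dsimp only
  rw [← mul_pow]
  have := T.le_opNorm (F ω)
  gcongr

/-- With `b_k = N_k (k+1+c)^α`, the hypothesis on `X` keeps `b_k E‖X_{k+1}‖²` bounded, so the first
sum is `O(√b_k)` in `L²`, and `b_k / W_k = O(k^{α-1})`. For the second, `W_k E‖r_{k+1}‖² =
O(k^{q+1-s})` tends to zero, as `tendsto_sum_div_sqrt_sum` requires. -/
theorem tendsto_remainder {N : ℕ → ℝ} {c α q s K : ℝ} (hN : SampleSizeAssumption N q)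
    (hq : 0 ≤ q) (hc : 0 ≤ c) (hα0 : 0 < α) (hα1 : α < 1) (hs : q + 1 < s) (hK : 0 ≤ K)
    {X r : ℕ → Ω → E} (hX : ∀ k, MemLp (X k) 2 P) (hr : ∀ k, MemLp (r k) 2 P)
    (hXb : ∀ k : ℕ, k ≥ 1 → ∫ ω, ‖X k ω‖ ^ 2 ∂P ≤ K * (k : ℝ) ^ (-(α + q)))
    (hrb : ∀ k : ℕ, k ≥ 1 → ∫ ω, ‖r k ω‖ ^ 2 ∂P ≤ K * (k : ℝ) ^ (-s)) (T : E →L[ℝ] E) :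
    Tendsto (fun k => √(∫ ω, ‖T (∑ i ∈ Finset.Icc 1 k,
        (N i * ((i : ℝ) + 1 + c) ^ α) • (X (i + 1) ω - X (i + 2) ω))
        - ∑ i ∈ Finset.Icc 1 k, N i • r (i + 1) ω‖ ^ 2 ∂P) / √(∑ i ∈ Finset.Icc 1 k, N i))
      atTop (𝓝 0) := by
  obtain ⟨a₀, B, -, hB, hNB⟩ := hN.exists_bounds
  obtain ⟨a, B', ha, hB', hWb⟩ := hN.exists_sum_bounds hq
  set W : ℕ → ℝ := fun k => ∑ i ∈ Finset.Icc 1 k, N i with hWdef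
  set b : ℕ → ℝ := fun k => N k * ((k : ℝ) + 1 + c) ^ α with hbdef
  have hW0 : ∀ k, 0 ≤ W k := fun k =>
    Finset.sum_nonneg fun i hi => (hN.pos i (Finset.mem_Icc.mp hi).1).le
  have hb0 : ∀ k ≥ 1, 0 < b k := fun k hk => by
    have := hN.pos k hk
    positivity
  have hbmono : ∀ k ≥ 1, b k ≤ b (k + 1) := fun k hk => by
    have h1 := hN.mono k hk
    have h2 := (hN.pos (k + 1) (by omega)).le
    simp only [hbdef]
    push_cast
    gcongr
    linarith
  have hWtop : Tendsto W atTop atTop := by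
    refine tendsto_atTop_mono' _ ?_ (((tendsto_rpow_atTop (by linarith : 0 < q + 1)).comp
      tendsto_natCast_atTop_atTop).const_mul_atTop ha)
    filter_upwards [eventually_ge_atTop 1] with k hk using (hWb k hk).1
  set K' : ℝ := √(B * K * (1 + c) ^ α) with hK'
  have he : ∀ k ≥ 1, √(b k) * √(∫ ω, ‖X (k + 1) ω‖ ^ 2 ∂P) ≤ K' := by
    intro k hk
    have hkpos : (0 : ℝ) < (k : ℝ) + 1 := by positivity
    rw [← Real.sqrt_mul (hb0 k hk).le]
    apply Real.sqrt_le_sqrt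
    have h1 := hXb (k + 1) (by omega)
    push_cast at h1
    have h2 : ((k : ℝ) + 1 + c) ^ α ≤ (1 + c) ^ α * ((k : ℝ) + 1) ^ α := by
      rw [← Real.mul_rpow (by positivity) (by positivity)]
      gcongr
      nlinarith [k.cast_nonneg (α := ℝ)]
    have h3 : N k ≤ B * ((k : ℝ) + 1) ^ q := by
      refine (hNB k hk).2.trans ?_
      gcongr
      linarith
    calc b k * ∫ ω, ‖X (k + 1) ω‖ ^ 2 ∂P
        ≤ (B * ((k : ℝ) + 1) ^ q * ((1 + c) ^ α * ((k : ℝ) + 1) ^ α))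
          * (K * ((k : ℝ) + 1) ^ (-(α + q))) := by
          refine mul_le_mul (mul_le_mul h3 h2 (by positivity) (by positivity)) h1
            (integral_nonneg fun ω => by positivity) (by positivity)
      _ = B * K * (1 + c) ^ α
          * (((k : ℝ) + 1) ^ q * ((k : ℝ) + 1) ^ α * ((k : ℝ) + 1) ^ (-(α + q))) := by ring
      _ = B * K * (1 + c) ^ α := by
          rw [← Real.rpow_add hkpos, ← Real.rpow_add hkpos,
            show q + α + -(α + q) = 0 by ring, Real.rpow_zero, mul_one]
  have hbW : Tendsto (fun k => √(b k) / √(W k)) atTop (𝓝 0) := by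
    have h1 : Tendsto (fun k : ℕ => B * (2 + c) ^ α / a * (k : ℝ) ^ (-(1 - α))) atTop (𝓝 0) := by
      simpa using ((tendsto_rpow_neg_atTop (by linarith : 0 < 1 - α)).comp
        tendsto_natCast_atTop_atTop).const_mul (B * (2 + c) ^ α / a)
    have h2 : Tendsto (fun k => b k / W k) atTop (𝓝 0) := by
      refine squeeze_zero' ?_ ?_ h1
      · filter_upwards [eventually_ge_atTop 1] with k hk
        exact div_nonneg (hb0 k hk).le (hW0 k)
      · filter_upwards [eventually_ge_atTop 1] with k hk
        have hk1 : (1 : ℝ) ≤ k := by exact_mod_cast hk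
        have hkpos : (0 : ℝ) < k := by linarith
        obtain ⟨hl, -⟩ := hWb k hk
        have h3 : ((k : ℝ) + 1 + c) ^ α ≤ (2 + c) ^ α * (k : ℝ) ^ α := by
          rw [← Real.mul_rpow (by positivity) (by positivity)]
          gcongr
          nlinarith
        have h4 := (hNB k hk).2
        calc b k / W k ≤ (B * (k : ℝ) ^ q * ((2 + c) ^ α * (k : ℝ) ^ α))
              / (a * (k : ℝ) ^ (q + 1)) := by
              refine div_le_div₀ (by positivity) ?_ (by positivity) hl
              exact mul_le_mul h4 h3 (by positivity) (by positivity)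
          _ = B * (2 + c) ^ α / a * ((k : ℝ) ^ q * (k : ℝ) ^ α * ((k : ℝ) ^ (q + 1))⁻¹) := by
              field_simp
          _ = _ := by
              rw [← Real.rpow_neg hkpos.le, ← Real.rpow_add hkpos, ← Real.rpow_add hkpos]
              congr 2; ring
    have h5 := (Real.continuous_sqrt.tendsto 0).comp h2
    rw [Real.sqrt_zero] at h5
    exact h5.congr fun k => Real.sqrt_div' _ (hW0 k)
  have hrW : Tendsto (fun k => √(W k) * √(∫ ω, ‖r (k + 1) ω‖ ^ 2 ∂P)) atTop (𝓝 0) := by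
    have h1 : Tendsto (fun k : ℕ => B' * K * (k : ℝ) ^ (-(s - (q + 1)))) atTop (𝓝 0) := by
      simpa using ((tendsto_rpow_neg_atTop (by linarith : 0 < s - (q + 1))).comp
        tendsto_natCast_atTop_atTop).const_mul (B' * K)
    have h2 : Tendsto (fun k => W k * ∫ ω, ‖r (k + 1) ω‖ ^ 2 ∂P) atTop (𝓝 0) := by
      refine squeeze_zero' ?_ ?_ h1
      · exact Eventually.of_forall fun k =>
          mul_nonneg (hW0 k) (integral_nonneg fun ω => by positivity)
      · filter_upwards [eventually_ge_atTop 1] with k hk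
        have hkpos : (0 : ℝ) < k := by exact_mod_cast hk
        have h3 := hrb (k + 1) (by omega)
        push_cast at h3
        have h4 : ((k : ℝ) + 1) ^ (-s) ≤ (k : ℝ) ^ (-s) :=
          Real.rpow_le_rpow_of_nonpos hkpos (by linarith) (by linarith)
        calc _ ≤ (B' * (k : ℝ) ^ (q + 1)) * (K * (k : ℝ) ^ (-s)) := by
              refine mul_le_mul (hWb k hk).2 (h3.trans ?_)
                (integral_nonneg fun ω => by positivity) (by positivity)
              gcongr
          _ = B' * K * ((k : ℝ) ^ (q + 1) * (k : ℝ) ^ (-s)) := by ring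
          _ = _ := by rw [← Real.rpow_add hkpos]; congr 2; ring
    have h5 := (Real.continuous_sqrt.tendsto 0).comp h2
    rw [Real.sqrt_zero] at h5
    exact h5.congr fun k => Real.sqrt_mul (hW0 k) _
  have hsum := tendsto_sum_div_sqrt_sum (w := N)
    (u := fun k => √(∫ ω, ‖r (k + 1) ω‖ ^ 2 ∂P)) (fun k hk => hN.pos k hk) hWtop hrW
  have hbound := (hbW.const_mul (‖T‖ * (3 * K'))).add hsum
  rw [mul_zero, add_zero] at hbound
  refine squeeze_zero' (Eventually.of_forall fun k => by positivity) ?_ hbound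
  filter_upwards [eventually_ge_atTop 1] with k hk
  have m1 : MemLp (fun ω => ∑ i ∈ Finset.Icc 1 k, b i • (X (i + 1) ω - X (i + 2) ω)) 2 P :=
    memLp_finsetSum _ fun i _ => ((hX (i + 1)).sub (hX (i + 2))).const_smul (b i)
  have m2 : MemLp (fun ω => ∑ i ∈ Finset.Icc 1 k, N i • r (i + 1) ω) 2 P :=
    memLp_finsetSum _ fun i _ => (hr (i + 1)).const_smul (N i)
  rw [mul_div_assoc', ← add_div]
  refine div_le_div_of_nonneg_right ?_ (Real.sqrt_nonneg _)
  refine (sqrt_integral_norm_sub_le (T.comp_memLp' m1) m2).trans (add_le_add ?_ ?_)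
  · refine (sqrt_integral_norm_map_le T m1).trans ?_
    rw [mul_assoc]
    exact mul_le_mul_of_nonneg_left
      (sqrt_integral_norm_sum_smul_sub_le hX (Real.sqrt_nonneg _) hb0 hbmono he hk) (norm_nonneg T)
  · exact sqrt_integral_norm_sum_smul_le _ (fun i hi => (hN.pos i (Finset.mem_Icc.mp hi).1).le)
      (fun i => hr (i + 1))

end Remainder

/-- For `p = 4` the strict inequality is exactly `α > (1 - q) / 2`. If only three moments are
available, the floor must vanish, so `α - (1 - q) / 2 > 1` and `p = 3` already suffices. -/
theorem exists_moment_order {α q : ℝ} {M : ℕ} (hα0 : 0 < α) (hαq : (1 - q) / 2 < α) (hα1 : α < 1)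
    (hM3 : 3 ≤ M) (hM2 : 2 * ⌊1 / (α - (1 - q) / 2)⌋₊ + 2 ≤ M) :
    ∃ p : ℕ, (p = 3 ∨ p = 4) ∧ p ≤ M ∧ q + 1 < (α + q) * p / 2 := by
  rcases Nat.lt_or_ge M 4 with h | h
  · refine ⟨3, Or.inl rfl, hM3, ?_⟩
    have h0 : ⌊1 / (α - (1 - q) / 2)⌋₊ = 0 := by omega
    rw [Nat.floor_eq_zero, div_lt_one (by linarith)] at h0
    push_cast
    linarith
  · refine ⟨4, Or.inr rfl, h, ?_⟩
    push_cast
    linarith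

theorem toEuclideanCLM_inv_apply {n : ℕ} {A : Matrix (Fin n) (Fin n) ℝ} (hA : A.PosDef)
    (v : EuclideanSpace ℝ (Fin n)) :
    Matrix.toEuclideanCLM (𝕜 := ℝ) A⁻¹ (Matrix.toEuclideanCLM (𝕜 := ℝ) A v) = v := by
  have := congrArg (fun T => Matrix.toEuclideanCLM (𝕜 := ℝ) T v)
    (Matrix.nonsing_inv_mul A (isUnit_iff_ne_zero.mpr hA.det_pos.ne'))
  simpa [map_mul] using this

theorem tendsto_integral_map_mul {n : ℕ} {Ω : Type*} {mΩ : MeasurableSpace Ω} {P : Measure Ω}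
    {Z : ℕ → Ω → EuclideanSpace ℝ (Fin n)} {W : ℕ → ℝ} {Sig : Matrix (Fin n) (Fin n) ℝ}
    (hZ : ∀ k, MemLp (Z k) 2 P)
    (hlim : ∀ a b, Tendsto (fun k => (∫ ω, Z k ω a * Z k ω b ∂P) / W k) atTop (𝓝 (Sig a b)))
    (B : Matrix (Fin n) (Fin n) ℝ) (i j : Fin n) :
    Tendsto (fun k => (∫ ω, Matrix.toEuclideanCLM (𝕜 := ℝ) B (Z k ω) i
      * Matrix.toEuclideanCLM (𝕜 := ℝ) B (Z k ω) j ∂P) / W k) atTop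
      (𝓝 ((B * Sig * B.transpose) i j)) := by
  have hproj : ∀ k (c : Fin n), MemLp (fun ω => Z k ω c) 2 P := fun k c =>
    (EuclideanSpace.proj (𝕜 := ℝ) c).comp_memLp' (hZ k)
  have h1 : Tendsto (fun k => ∑ b, ∑ a, B i a * ((∫ ω, Z k ω a * Z k ω b ∂P) / W k) * B j b) atTop
      (𝓝 (∑ b, ∑ a, B i a * Sig a b * B j b)) :=
    tendsto_finsetSum _ fun b _ => tendsto_finsetSum _ fun a _ =>
      ((hlim a b).const_mul _).mul_const _
  have e1 : (B * Sig * B.transpose) i j = ∑ b, ∑ a, B i a * Sig a b * B j b := by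
    simp only [Matrix.mul_apply, Matrix.transpose_apply, Finset.sum_mul]
  rw [e1]
  refine h1.congr fun k => ?_
  have e2 : ∀ ω, Matrix.toEuclideanCLM (𝕜 := ℝ) B (Z k ω) i
      * Matrix.toEuclideanCLM (𝕜 := ℝ) B (Z k ω) j
      = ∑ b, ∑ a, B i a * B j b * (Z k ω a * Z k ω b) := fun ω => by
    rw [Matrix.ofLp_toEuclideanCLM]
    simp only [Matrix.mulVec, dotProduct, Finset.sum_mul_sum]
    rw [Finset.sum_comm]
    refine Finset.sum_congr rfl fun b _ => Finset.sum_congr rfl fun a _ => by ring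
  simp only [e2]
  have hint : ∀ a b, Integrable (fun ω => B i a * B j b * (Z k ω a * Z k ω b)) P := fun a b =>
    ((hproj k a).integrable_mul (hproj k b)).const_mul _
  rw [integral_finsetSum _ fun b _ => integrable_finsetSum _ fun a _ => hint a b, Finset.sum_div]
  refine Finset.sum_congr rfl fun b _ => ?_
  rw [integral_finsetSum _ fun a _ => hint a b, Finset.sum_div]
  refine Finset.sum_congr rfl fun a _ => ?_
  rw [integral_const_mul]
  ring

theorem averagedNext_sub {n : ℕ} {Ω : Type*} {N : ℕ → ℝ} {x : ℕ → Ω → EuclideanSpace ℝ (Fin n)}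
    (xs : EuclideanSpace ℝ (Fin n)) {k : ℕ} (hW : ∑ i ∈ Finset.Icc 1 k, N i ≠ 0) (ω : Ω) :
    averagedNext N x k ω - xs = (∑ i ∈ Finset.Icc 1 k, N i)⁻¹ •
      ∑ i ∈ Finset.Icc 1 k, N i • (x (i + 1) ω - xs) := by
  simp only [smul_sub, Finset.sum_sub_distrib, ← Finset.sum_smul, averagedNext]
  rw [smul_smul, inv_mul_cancel₀ hW, one_smul]

end IncreasingPrecision

/-! ### Linearisation of the averaged recursion and the limit -/

set_option maxHeartbeats 400000 in
open IncreasingPrecision in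
theorem mainTheorem2 {n : ℕ} {Ω : Type*} {mΩ : MeasurableSpace Ω} (P : Measure Ω)
    [IsProbabilityMeasure P] (ℱ : Filtration ℕ mΩ)
    (f : EuclideanSpace ℝ (Fin n) → ℝ) (xs : EuclideanSpace ℝ (Fin n))
    (A : ℕ → Matrix (Fin n) (Fin n) ℝ) (D : Matrix (Fin n) (Fin n) ℝ)
    (ε x : ℕ → Ω → EuclideanSpace ℝ (Fin n)) (N : ℕ → ℝ)
    (Sig2 : Matrix (Fin n) (Fin n) ℝ) (c α q : ℝ) (M : ℕ)
    (hproc : IncreasingPrecision.IsProcess P ℱ f A ε x)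
    (hconv : IncreasingPrecision.ConvexityAssumption f xs)
    (hmom : IncreasingPrecision.MomentAssumption P ℱ N ε M)
    (hc : 0 ≤ c) (hD : D.PosDef)
    (hA : ∀ k : ℕ, 1 ≤ k → A k = ((k : ℝ) + c) ^ (-α) • D)
    (hq : 0 ≤ q) (hN : IncreasingPrecision.SampleSizeAssumption N q)
    (hcov : IncreasingPrecision.CovarianceAssumption P N ε x xs Sig2)
    (hC3 : ContDiffAt ℝ 3 f xs)
    (hα0 : 0 < α) (hαq : (1 - q) / 2 < α) (hα1 : α < 1)
    (hM3 : 3 ≤ M)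
    (hM1 : 2 * ⌊1 / (α + q)⌋₊ + 2 ≤ M)
    (hM2 : 2 * ⌊1 / (α - (1 - q) / 2)⌋₊ + 2 ≤ M) :
    (∀ k ≥ 1, ∀ i j, Integrable (fun ω =>
      (IncreasingPrecision.averagedNext N x k ω - xs) i *
        (IncreasingPrecision.averagedNext N x k ω - xs) j) P) ∧
    Tendsto (fun k : ℕ => (∑ i ∈ Finset.Icc 1 k, N i) •
        IncreasingPrecision.secondMoment P (IncreasingPrecision.averagedNext N x k) xs)
      atTop
      (𝓝 ((IncreasingPrecision.hessian f xs)⁻¹ * Sig2 * (IncreasingPrecision.hessian f xs)⁻¹)) := by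
  obtain ⟨p, hp, hpM, hexp⟩ := exists_moment_order hα0 hαq hα1 hM3 hM2
  obtain ⟨l, -, hlip⟩ := hconv.exists_norm_gradient_le
  obtain ⟨Cρ, hCρ, hρ⟩ := exists_quadratic_remainder hconv.differentiable_gradient
    (contDiffAt_gradient hC3) hlip
  set S := hessian f xs with hS
  have hSpd : S.PosDef := hconv.posDef xs
  set H := fderiv ℝ (gradient f) xs with hH
  have hSH : Matrix.toEuclideanCLM (𝕜 := ℝ) S = H := toEuclideanCLM_hessian f xs
  set ρ : EuclideanSpace ℝ (Fin n) → EuclideanSpace ℝ (Fin n) :=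
    fun v => gradient f (xs + v) - H v with hρdef
  have hρc : Continuous ρ := (hconv.differentiable_gradient.continuous.comp
    (continuous_const.add continuous_id)).sub H.continuous
  obtain ⟨K, hK, hb⟩ := hproc.exists_moment_bounds hconv hmom hc hD hA hq hN hα0 hα1 hp hpM hρc
    hCρ (fun v => (hρ v).1) (fun v => (hρ v).2)
  set W : ℕ → ℝ := fun k => ∑ i ∈ Finset.Icc 1 k, N i with hW
  have hWpos : ∀ k ≥ 1, 0 < W k := fun k hk =>
    Finset.sum_pos (fun i hi => hN.pos i (Finset.mem_Icc.mp hi).1) ⟨1, by simp [hk]⟩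
  have hW0 : ∀ k, 0 ≤ W k := fun k =>
    Finset.sum_nonneg fun i hi => (hN.pos i (Finset.mem_Icc.mp hi).1).le
  obtain ⟨a, b', ha, -, hWb⟩ := hN.exists_sum_bounds hq
  have hWtop : Tendsto W atTop atTop := by
    refine tendsto_atTop_mono' _ ?_ (((tendsto_rpow_atTop (by linarith : 0 < q + 1)).comp
      tendsto_natCast_atTop_atTop).const_mul_atTop ha)
    filter_upwards [eventually_ge_atTop 1] with k hk using (hWb k hk).1
  -- The index `k - 1 + 1` replaces the unconstrained `x 0` by `x 1`, so that square integrability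
  -- holds for every `k`; for `k ≥ 1` nothing changes.
  set X : ℕ → Ω → EuclideanSpace ℝ (Fin n) := fun k ω => x (k - 1 + 1) ω - xs with hXdef
  set r : ℕ → Ω → EuclideanSpace ℝ (Fin n) := fun k ω => ρ (x (k - 1 + 1) ω - xs) with hrdef
  have hX : ∀ k, MemLp (X k) 2 P := fun k => (hb (k - 1 + 1) (by omega)).2.1
  have hr : ∀ k, MemLp (r k) 2 P := fun k => (hb (k - 1 + 1) (by omega)).2.2.1
  have hXb : ∀ k : ℕ, k ≥ 1 → ∫ ω, ‖X k ω‖ ^ 2 ∂P ≤ K * (k : ℝ) ^ (-(α + q)) := fun k hk => by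
    obtain ⟨k, rfl⟩ := Nat.exists_eq_add_of_le' hk
    exact (hb (k + 1) hk).2.2.2.1
  have hrb : ∀ k : ℕ, k ≥ 1 → ∫ ω, ‖r k ω‖ ^ 2 ∂P ≤ K * (k : ℝ) ^ (-((α + q) * p / 2)) :=
    fun k hk => by
      obtain ⟨k, rfl⟩ := Nat.exists_eq_add_of_le' hk
      exact (hb (k + 1) hk).2.2.2.2
  have hε2 : ∀ k ≥ 1, MemLp (ε k) 2 P := fun k hk => by
    obtain ⟨C, hC⟩ := hmom 2 le_rfl (by omega)
    exact (memLp_two_iff_integrable_sq_norm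
      ((hproc.noise_measurable k hk).mono (ℱ.le k)).aestronglyMeasurable).mpr (hC k hk).1
  set Y : ℕ → Ω → EuclideanSpace ℝ (Fin n) :=
    fun k ω => ∑ i ∈ Finset.Icc 1 k, N i • ε (i + 1) ω with hYdef
  set T : ℕ → Ω → EuclideanSpace ℝ (Fin n) :=
    fun k ω => ∑ i ∈ Finset.Icc 1 k, N i • X (i + 1) ω with hTdef
  set Dinv := Matrix.toEuclideanCLM (𝕜 := ℝ) D⁻¹ with hDinv
  set R : ℕ → Ω → EuclideanSpace ℝ (Fin n) := fun k ω => Dinv (∑ i ∈ Finset.Icc 1 k,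
      (N i * ((i : ℝ) + 1 + c) ^ α) • (X (i + 1) ω - X (i + 2) ω))
      - ∑ i ∈ Finset.Icc 1 k, N i • r (i + 1) ω with hRdef
  have hY : ∀ k, MemLp (Y k) 2 P := fun k =>
    memLp_finsetSum _ fun i _ => (hε2 (i + 1) (by omega)).const_smul (N i)
  have hT : ∀ k, MemLp (T k) 2 P := fun k =>
    memLp_finsetSum _ fun i _ => (hX (i + 1)).const_smul (N i)
  have hR : ∀ k, MemLp (R k) 2 P := fun k => by
    have m1 : MemLp (fun ω => ∑ i ∈ Finset.Icc 1 k,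
        (N i * ((i : ℝ) + 1 + c) ^ α) • (X (i + 1) ω - X (i + 2) ω)) 2 P :=
      memLp_finsetSum _ fun i _ => ((hX (i + 1)).sub (hX (i + 2))).const_smul
        (N i * ((i : ℝ) + 1 + c) ^ α)
    have m2 : MemLp (fun ω => ∑ i ∈ Finset.Icc 1 k, N i • r (i + 1) ω) 2 P :=
      memLp_finsetSum _ fun i _ => (hr (i + 1)).const_smul (N i)
    exact (Dinv.comp_memLp' m1).sub m2
  -- The update at index `i + 1`, solved for the linearised drift; this is where the noise enters
  -- with coefficient exactly `-1`, free of `D` and of the step size.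
  have hstep : ∀ i ω, H (X (i + 1) ω) = ((i : ℝ) + 1 + c) ^ α • Dinv (X (i + 1) ω - X (i + 2) ω)
      - r (i + 1) ω - ε (i + 1) ω := by
    intro i ω
    have h1 : X (i + 1) ω - X (i + 2) ω = ((i : ℝ) + 1 + c) ^ (-α) •
        Matrix.toEuclideanCLM (𝕜 := ℝ) D (gradient f (x (i + 1) ω) + ε (i + 1) ω) := by
      change x (i + 1) ω - xs - (x (i + 1 + 1) ω - xs) = _
      rw [hproc.update (i + 1) (by omega) ω, hA (i + 1) (by omega), map_smul, smul_apply]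
      push_cast
      abel
    have h2 : r (i + 1) ω = gradient f (x (i + 1) ω) - H (X (i + 1) ω) := by
      change gradient f (xs + (x (i + 1) ω - xs)) - H (x (i + 1) ω - xs) = _
      rw [add_sub_cancel]
      rfl
    have h3 : (0 : ℝ) < (i : ℝ) + 1 + c := by positivity
    rw [h1, map_smul, hDinv, toEuclideanCLM_inv_apply hD, smul_smul, ← Real.rpow_add h3,
      add_neg_cancel, Real.rpow_zero, one_smul, h2]
    abel
  have hZ : ∀ k ω, H (T k ω) = R k ω - Y k ω := by
    intro k ω
    simp only [hTdef, hRdef, hYdef, map_sum, map_smul, map_sub, hstep, smul_sub, smul_smul,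
      Finset.sum_sub_distrib]
  have hRlim : Tendsto (fun k => √(∫ ω, ‖R k ω‖ ^ 2 ∂P) / √(W k)) atTop (𝓝 0) :=
    tendsto_remainder hN hq hc hα0 hα1 hexp hK hX hr hXb hrb Dinv
  have hcovlim : ∀ i j, Tendsto (fun k => N k * ∫ ω, ε k ω i * ε k ω j ∂P) atTop
      (𝓝 (Sig2 i j)) := by
    obtain ⟨C, hC⟩ := hmom 2 le_rfl (by omega)
    have htail : Tendsto (fun k => ∫ ω, ‖x k ω - xs‖ ^ 2 ∂P) atTop (𝓝 0) := by
      have h1 : Tendsto (fun k : ℕ => K * (k : ℝ) ^ (-(α + q))) atTop (𝓝 0) := by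
        simpa using ((tendsto_rpow_neg_atTop (by linarith : 0 < α + q)).comp
          tendsto_natCast_atTop_atTop).const_mul K
      refine squeeze_zero' (Eventually.of_forall fun k => integral_nonneg fun ω => by positivity)
        ?_ h1
      filter_upwards [eventually_ge_atTop 1] with k hk using (hb k hk).2.2.2.1
    exact tendsto_noise_covariance (ℱ := ℱ) hcov (fun k hk => hN.pos k hk)
      (fun k hk => (hε2 k hk).aestronglyMeasurable) (abs_nonneg C)
      (fun k hk => ⟨(hC k hk).1, (hC k hk).2.mono fun ω hω => by
        refine le_trans (le_of_eq ?_) (hω.trans (le_abs_self C))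
        norm_num⟩)
      (fun k hk => (hb k hk).1)
      (fun k hk => (hb k hk).2.1.integrable_norm_pow two_ne_zero) htail
  have hYlim : ∀ a b, Tendsto (fun k => (∫ ω, Y k ω a * Y k ω b ∂P) / W k) atTop
      (𝓝 (Sig2 a b)) := by
    intro a b
    -- The weight `N i` is paired with the noise at `i + 1`, so `N_i² E[εεᵀ]` is read as `N_i · (N_i
    -- / N_{i+1}) · N_{i+1} E[εεᵀ]`, a weighted average of a convergent sequence.
    have h1 := hN.tendsto_ratio.mul ((tendsto_add_atTop_iff_nat 1).mpr (hcovlim a b))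
    rw [one_mul] at h1
    refine (tendsto_weighted_average (fun k hk => hN.pos k hk) hWtop h1).congr fun k => ?_
    rw [integral_weighted_noise_sum_mul hproc.noise_measurable hε2 hproc.noise_mean_zero]
    congr 1
    refine Finset.sum_congr rfl fun i hi => ?_
    have := (hN.pos (i + 1) (by omega)).ne'
    field_simp
  have hSinv : ∀ k ω, Matrix.toEuclideanCLM (𝕜 := ℝ) S⁻¹ (H (T k ω)) = T k ω := fun k ω => by
    rw [← hSH, toEuclideanCLM_inv_apply hSpd]
  have havg : ∀ k ≥ 1, ∀ ω, averagedNext N x k ω - xs = (W k)⁻¹ • T k ω := fun k hk ω =>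
    averagedNext_sub xs (hWpos k hk).ne' ω
  have hTi : ∀ k i j, Integrable (fun ω => T k ω i * T k ω j) P := fun k i j =>
    ((EuclideanSpace.proj (𝕜 := ℝ) i).comp_memLp' (hT k)).integrable_mul
      ((EuclideanSpace.proj (𝕜 := ℝ) j).comp_memLp' (hT k))
  have hprod : ∀ k ≥ 1, ∀ i j ω, (averagedNext N x k ω - xs) i * (averagedNext N x k ω - xs) j
      = (W k)⁻¹ ^ 2 * (T k ω i * T k ω j) := fun k hk i j ω => by
    rw [havg k hk, PiLp.smul_apply, PiLp.smul_apply, smul_eq_mul, smul_eq_mul]; ring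
  refine ⟨fun k hk i j => ?_, ?_⟩
  · simp only [hprod k hk]
    exact (hTi k i j).const_mul _
  · refine tendsto_pi_nhds.mpr fun i => tendsto_pi_nhds.mpr fun j => ?_
    -- The limit is first known for `H (T k)`; applying `S⁻¹` recovers `T k` and sandwiches `Sig2`
    -- between `S⁻¹` and its transpose.
    have h1 := tendsto_integral_map_mul (fun k => H.comp_memLp' (hT k))
      (tendsto_integral_mul_of_perturbation hY hR hZ hW0 hYlim hRlim) S⁻¹ i j
    have hsymm : S⁻¹.transpose = S⁻¹ := by
      have := hSpd.inv.isHermitian.eq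
      rwa [Matrix.conjTranspose_eq_transpose_of_trivial] at this
    simp only [Function.comp_apply, hSinv, hsymm] at h1
    refine h1.congr' ?_
    filter_upwards [eventually_ge_atTop 1] with k hk
    rw [Matrix.smul_apply, secondMoment, Matrix.of_apply]
    simp only [hprod k hk]
    rw [integral_const_mul, smul_eq_mul]
    have := (hWpos k hk).ne'
    change _ = W k * _
    field_simp
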